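/- A two-qutrit state is a positive semidefinite complex matrix $\rho$ of trace $1$ on $\mathbb C^3\otimes\mathbb C^3$; it is PPT if its partial transpose is positive semidefinite, and $\mathcal{AP}_{3,3}$ (absolutely PPT states) is the convex set of all PPT states $\rho$ such that $U\rho U^\dagger$ is PPT for every unitary $9\times 9$ matrix $U$. For $1\le k\le 7$ and real numbers $a>b>c>0$ put $\nu_{1,k,8-k}=\mathrm{diag}(a,\underbrace{b,\dots,b}_{k},\underbrace{c,\dots,c}_{8-k})$ (in a product basis). Let $x=2.70928\ldots$ (rounded) be the largest root of $x^3-x^2-5x+1=0$, let $y=0.056991\ldots$ be the second (in ascending order) of the three real roots of $481y^3-37y^2-17y+1=0$, and let $$\zeta_1=\tfrac1{11}\mathrm{diag}(3,1,\dots,1),\quad \zeta_2=\tfrac1{9+2\sqrt2}\mathrm{diag}(\sqrt2+1,\sqrt2+1,1,\dots,1),\quad \zeta_3=\tfrac1{12}\mathrm{diag}(2,2,2,1,\dots,1),$$ $$\zeta_4=\tfrac1{10+\sqrt{17}}\mathrm{diag}(\underbrace{\tfrac{5+\sqrt{17}}4,\dots,\tfrac{5+\sqrt{17}}4}_{4},1,1,1,1,1),\quad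 \zeta_5=\tfrac1{5x+4}\mathrm{diag}(x,x,x,x,x,1,1,1,1),$$ $$\zeta_7=\tfrac1{23+14\sqrt2}\mathrm{diag}(\underbrace{3+2\sqrt2,\dots,3+2\sqrt2}_{7},1,1),\quad \zeta_8=\tfrac18\mathrm{diag}(1,\dots,1,0).$$ Then, for real $a>b>c>0$, the matrix $\nu_{1,k,8-k}$ is an extreme point of $\mathcal{AP}_{3,3}$ if and only if $k\ne5$, $c$ lies in the open interval below, and $a,b$ are given by the formulas below; conversely, for $k\neq 5$, every $c$ in that interval yields by these formulas numbers $a>b>c>0$. Along each family, $\nu_{1,k,8-k}\to\zeta_1$ as $c\to\frac1{11}$ from below, and $\nu_{1,k,8-k}$ tends to the indicated state as $c$ tends from above to the lower end of the interval. * $k=1$: $a,b=\frac{1-7c\pm\sqrt{-73c^2+18c-1}}2$ ($+$ for $a$, $-$ for $b$), $\;0.084542\ldots=\frac{9-2\sqrt2}{73}<c<\frac1{11}=0.090909\ldots$, lower limit $\zeta_2$. * $k=2$: $a=1-10c+2\sqrt{12c^2-c}$, $b=2c-\sqrt{12c^2-c}$, $\;0.083333\ldots=\frac1{12}<c<\frac1{11}$,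 lower limit $\zeta_3$. * $k=3$: $a=\frac{1+10c-3\sqrt{108c^2-20c+1}}4$, $b=\frac{1-10c+\sqrt{108c^2-20c+1}}4$, $\;0.070805\ldots=\frac{10-\sqrt{17}}{83}<c<\frac1{11}$, lower limit $\zeta_4$. * $k=4$: $a=1-4b^{(1)}-4c$, $b=b^{(1)}$, where $b^{(1)}=b^{(1)}(c)$ is the second (in ascending order) of the three real roots of $16t^3+(41c-8)t^2+(19c^2-10c+1)t+c^3=0$, $\;y<c<\frac1{11}$, lower limit $\zeta_5$. * $k=5$: there are no extreme points of this form. * $k=6$: $a=\frac{2c+\sqrt{6c-17c^2}}3$, $b=\frac{3-8c-\sqrt{6c-17c^2}}{18}$, $\;0.023365\ldots=\frac{23-14\sqrt2}{137}<c<\frac1{11}$, lower limit $\zeta_7$. * $k=7$: $a=\frac{4-11c+7\sqrt{8c-7c^2}}{32}$, $b=\frac{4-3c-\sqrt{8c-7c^2}}{32}$, $\;0<c<\frac1{11}$, lower limit $\zeta_8$. -/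

import Mathlib

open Polynomial
open scoped ComplexOrder Topology

/-- Complex matrices acting on `ℂᵐ ⊗ ℂⁿ`, written in the product basis `e i ⊗ e j`. -/
abbrev BipartiteMatrix (m n : ℕ) : Type := Matrix (Fin m × Fin n) (Fin m × Fin n) ℂ

/-- A (mixed) state: a positive semidefinite matrix of trace one. -/
def IsState {m n : ℕ} (ρ : BipartiteMatrix m n) : Prop :=
  ρ.PosSemidef ∧ ρ.trace = 1

/-- The partial transpose with respect to the second tensor factor. -/
def partialTranspose {m n : ℕ} (ρ : BipartiteMatrix m n) : BipartiteMatrix m n :=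
  Matrix.of fun p q => ρ (p.1, q.2) (q.1, p.2)

/-- A PPT state: a state whose partial transpose is positive semidefinite. -/
def IsPPT {m n : ℕ} (ρ : BipartiteMatrix m n) : Prop :=
  IsState ρ ∧ (partialTranspose ρ).PosSemidef

/-- The set of `m × n` absolutely PPT states: the PPT states which remain PPT
under every global unitary conjugation. -/
def absolutelyPPT (m n : ℕ) : Set (BipartiteMatrix m n) :=
  {ρ | IsPPT ρ ∧ ∀ U ∈ Matrix.unitaryGroup (Fin m × Fin n) ℂ, IsPPT (U * ρ * star U)}

/-- The diagonal two-qutrit matrix with the given nine real diagonal entries; the product basis is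
ordered lexicographically, so `e i ⊗ e j` carries the entry number `3 * i + j`. -/
noncomputable def diag9 (x : Fin 9 → ℝ) : BipartiteMatrix 3 3 :=
  Matrix.diagonal fun p => ((x (finProdFinEquiv p) : ℝ) : ℂ)

/-- `nu k a b c = diag (a, b, …, b, c, …, c)`, with `k` entries `b` and `8 - k` entries `c`. -/
noncomputable def nu (k : ℕ) (a b c : ℝ) : BipartiteMatrix 3 3 :=
  diag9 fun i => if (i : ℕ) = 0 then a else if (i : ℕ) ≤ k then b else c

noncomputable def zeta1 : BipartiteMatrix 3 3 :=
  diag9 fun i => (1 / 11) * (![3, 1, 1, 1, 1, 1, 1, 1, 1] : Fin 9 → ℝ) i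

noncomputable def zeta2 : BipartiteMatrix 3 3 :=
  diag9 fun i => (1 / (9 + 2 * √2)) *
    (![√2 + 1, √2 + 1, 1, 1, 1, 1, 1, 1, 1] : Fin 9 → ℝ) i

noncomputable def zeta3 : BipartiteMatrix 3 3 :=
  diag9 fun i => (1 / 12) * (![2, 2, 2, 1, 1, 1, 1, 1, 1] : Fin 9 → ℝ) i

noncomputable def zeta4 : BipartiteMatrix 3 3 :=
  diag9 fun i => (1 / (10 + √17)) *
    (![(5 + √17) / 4, (5 + √17) / 4, (5 + √17) / 4, (5 + √17) / 4, 1, 1, 1, 1, 1] :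
      Fin 9 → ℝ) i

/-- `zeta5 x`, to be used for the root `x ≈ 2.70928` of `x³ - x² - 5x + 1 = 0`. -/
noncomputable def zeta5 (x : ℝ) : BipartiteMatrix 3 3 :=
  diag9 fun i => (1 / (5 * x + 4)) * (![x, x, x, x, x, 1, 1, 1, 1] : Fin 9 → ℝ) i

noncomputable def zeta7 : BipartiteMatrix 3 3 :=
  diag9 fun i => (1 / (23 + 14 * √2)) *
    (![3 + 2 * √2, 3 + 2 * √2, 3 + 2 * √2, 3 + 2 * √2, 3 + 2 * √2, 3 + 2 * √2, 3 + 2 * √2, 1, 1] :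
      Fin 9 → ℝ) i

noncomputable def zeta8 : BipartiteMatrix 3 3 :=
  diag9 fun i => (1 / 8) * (![1, 1, 1, 1, 1, 1, 1, 1, 0] : Fin 9 → ℝ) i

/-- `nu k a b c` is an extreme point of the set of absolutely PPT two-qutrit states, of full rank
and with exactly the three distinct eigenvalues `a > b > c`. -/
def IsExtremeNu (k : ℕ) (a b c : ℝ) : Prop :=
  0 < c ∧ c < b ∧ b < a ∧ nu k a b c ∈ Set.extremePoints ℝ (absolutelyPPT 3 3)

/-- One row of the classification. The full-rank extreme points `diag (a, b^k, c^(8-k))` with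
`a > b > c` are exactly those with `lo < c < hi`, `a = A c` and `b = B c`; along this curve they
converge to `Zhi` as `c` tends to `hi` and to `Zlo` as `c` tends to `lo`. -/
def IsTableRow (k : ℕ) (A B : ℝ → ℝ) (lo hi : ℝ) (Zhi Zlo : BipartiteMatrix 3 3) : Prop :=
  (∀ a b c : ℝ, IsExtremeNu k a b c ↔ (lo < c ∧ c < hi ∧ a = A c ∧ b = B c)) ∧
  Filter.Tendsto (fun c => nu k (A c) (B c) c) (𝓝[<] hi) (𝓝 Zhi) ∧
  Filter.Tendsto (fun c => nu k (A c) (B c) c) (𝓝[>] lo) (𝓝 Zlo)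

/-- `r` is the second root of the real cubic `p`: all three roots of `p`, counted with
multiplicity, are real, and `r` is the second one in ascending order. -/
def IsSecondRoot (p : ℝ[X]) (r : ℝ) : Prop :=
  ∃ r₁ r₃ : ℝ, r₁ ≤ r ∧ r ≤ r₃ ∧ p.roots = {r₁, r, r₃}

/-! ### Unitary matrices and doubly stochastic matrices -/

/-! A state ρ is absolutely PPT exactly when tr(UρU† · |ψ⟩⟨ψ|^Γ) ≥ 0 for all unitaries U and vectors
ψ. If ψ has Schmidt coefficients s, then |ψ⟩⟨ψ|^Γ has eigenvalues s_i² and ±s_i s_j, and by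
Birkhoff's theorem the trace is minimal over U when the two spectra are paired by a permutation.
Membership is therefore a condition on the spectrum x alone: all its pairings with these eigenvalues
are nonnegative (`diagonal_mem_absolutelyPPT_iff`). Each pairing is a quadratic form in s, and for
decreasing x the rearrangement inequality leaves only two orders to test
(`mem_pptSpectra_of_antitone`). For the spectra (a, b, …, b, c, …, c) these two orders differ only
when k = 5.

Extremality also passes to spectra (`diag9_mem_extremePoints_iff`), through the diagonals of the two
endpoints of a segment and a comparison of Frobenius norms.

For k ≠ 5 and a > b > c > 0 of trace one, membership is a single polynomial inequality G ≥ 0. If G >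
0, the spectrum can be moved both ways at constant trace, so it is not extreme. If G = 0, the form
has a kernel vector, which is also a kernel vector for the endpoints of any segment through the
point; this and the exchange of equal entries make the endpoints proportional to the point, hence
equal to it (`isExtremeNu_iff_of_boundary`). For k = 5 the binding condition a ≤ 3c is linear, and a
segment inside a level set of a - 3c passes through every candidate.

The trace condition and G = 0 then define a curve over c, with b = c at the end c = 1/11 and a = b
at the lower end. For k ≠ 4 it is found from a quadratic equation, where c < b < a selects the sign
of the root and the interval. For k = 4, b is a root of a cubic whose values at c and at (1 - 4c)/5
have opposite signs, and polynomial estimates squeeze b at both ends. -/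

lemma conj_diagonal_apply_self {n : Type*} [Fintype n] [DecidableEq n]
    (T : Matrix n n ℂ) (y : n → ℝ) (p : n) :
    (T * Matrix.diagonal (fun q => (y q : ℂ)) * star T) p p
      = ((∑ q, Complex.normSq (T p q) * y q : ℝ) : ℂ) := by
  rw [Matrix.mul_apply]
  push_cast
  refine Finset.sum_congr rfl fun q _ => ?_
  rw [Matrix.mul_diagonal, Matrix.star_apply, ← Complex.mul_conj]
  simp only [Complex.star_def]
  ring

lemma normSq_mem_doublyStochastic {n : Type*} [Fintype n] [DecidableEq n]
    {T : Matrix n n ℂ} (hT : T ∈ Matrix.unitaryGroup n ℂ) :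
    (Matrix.of fun p q => Complex.normSq (T p q)) ∈ doublyStochastic ℝ n := by
  rw [mem_doublyStochastic_iff_sum]
  refine ⟨fun p q => Complex.normSq_nonneg _, fun p => ?_, fun q => ?_⟩
  · have h := congrFun (congrFun (Matrix.mem_unitaryGroup_iff.1 hT) p) p
    rw [Matrix.mul_apply, Matrix.one_apply_eq] at h
    have h' : ((∑ j, Complex.normSq (T p j) : ℝ) : ℂ) = 1 := by
      rw [← h]; push_cast
      exact Finset.sum_congr rfl fun q _ => by rw [Matrix.star_apply, ← Complex.mul_conj]; rfl
    exact_mod_cast h'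
  · have h := congrFun (congrFun (Matrix.mem_unitaryGroup_iff'.1 hT) q) q
    rw [Matrix.mul_apply, Matrix.one_apply_eq] at h
    have h' : ((∑ j, Complex.normSq (T j q) : ℝ) : ℂ) = 1 := by
      rw [← h]; push_cast
      exact Finset.sum_congr rfl fun p _ => by
        rw [Matrix.star_apply, ← Complex.mul_conj, mul_comm]; rfl
    exact_mod_cast h'

/-- The Schur half of the Schur–Horn theorem: the squared moduli of a unitary form a doubly
stochastic matrix, which Birkhoff's theorem writes as a convex combination of permutation matrices.
The left side is the diagonal of T diag(y) T†. -/
lemma sum_normSq_mem_convexHull {n : Type*} [Fintype n] [DecidableEq n]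
    {T : Matrix n n ℂ} (hT : T ∈ Matrix.unitaryGroup n ℂ) (y : n → ℝ) :
    (fun p => ∑ q, Complex.normSq (T p q) * y q) ∈
      convexHull ℝ (Set.range fun σ : Equiv.Perm n => y ∘ σ) := by
  have h := normSq_mem_doublyStochastic hT
  rw [← SetLike.mem_coe, doublyStochastic_eq_convexHull_permMatrix] at h
  let L : Matrix n n ℝ →ₗ[ℝ] (n → ℝ) := (Matrix.mulVecBilin ℝ ℝ).flip y
  have h2 := Set.mem_image_of_mem L h
  rw [LinearMap.image_convexHull] at h2
  have hL : L (Matrix.of fun p q => Complex.normSq (T p q))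
      = fun p => ∑ q, Complex.normSq (T p q) * y q := by
    ext p; simp [L, Matrix.mulVec, dotProduct]
  rw [hL] at h2
  refine convexHull_mono ?_ h2
  rintro _ ⟨_, ⟨σ, rfl⟩, rfl⟩
  refine ⟨σ, ?_⟩
  ext p
  simp [L, Matrix.permMatrix_mulVec]

/-! ### Singular value decomposition of a square matrix -/

/-- An eigenbasis W of A†A makes the columns of AW orthogonal. The nonzero columns are normalised
and completed to an orthonormal basis, which gives V. -/
theorem Matrix.exists_svd {n : Type*} [Fintype n] [DecidableEq n] (A : Matrix n n ℂ) :
    ∃ V ∈ Matrix.unitaryGroup n ℂ, ∃ W ∈ Matrix.unitaryGroup n ℂ, ∃ s : n → ℝ,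
      A = V * Matrix.diagonal (fun i => (s i : ℂ)) * W := by
  have hA : (star A * A).IsHermitian := Matrix.isHermitian_conjTranspose_mul_self A
  set W : Matrix n n ℂ := (hA.eigenvectorUnitary : Matrix n n ℂ) with hW
  have hWu : W ∈ Matrix.unitaryGroup n ℂ := hA.eigenvectorUnitary.2
  set d := hA.eigenvalues
  set B := A * W with hB
  have hBB : star B * B = Matrix.diagonal (fun i => (d i : ℂ)) := by
    have h := hA.conjStarAlgAut_star_eigenvectorUnitary
    rw [Unitary.conjStarAlgAut_apply] at h
    simp only [star_star, Unitary.coe_star] at h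
    rw [hB, star_mul]
    simp only [← mul_assoc] at h ⊢
    exact h
  have hBe : ∀ k l, ∑ i, star (B i k) * B i l = if k = l then (d k : ℂ) else 0 := by
    intro k l
    have h := congrFun (congrFun hBB k) l
    rw [Matrix.mul_apply, Matrix.diagonal_apply] at h
    exact h
  have hd : ∀ k, 0 ≤ d k := fun k =>
    (Matrix.posSemidef_conjTranspose_mul_self A).eigenvalues_nonneg k
  let v : n → EuclideanSpace ℂ n := fun k => WithLp.toLp 2 fun i => B i k * ((√(d k))⁻¹ : ℝ)
  have hv : Orthonormal ℂ (Set.domRestrict ({k | d k ≠ 0} : Set n) v) := by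
    rw [orthonormal_iff_ite]
    rintro ⟨k, hk⟩ ⟨l, hl⟩
    have hk' : d k ≠ 0 := hk
    have : inner ℂ (v k) (v l)
        = (((√(d k))⁻¹ : ℝ) : ℂ) * ((√(d l))⁻¹ : ℝ) * ∑ i, star (B i k) * B i l := by
      rw [PiLp.inner_apply, Finset.mul_sum]
      refine Finset.sum_congr rfl fun i _ => ?_
      simp only [v, RCLike.inner_apply, map_mul, Complex.conj_ofReal, Complex.star_def]
      ring
    rw [Set.domRestrict_apply, Set.domRestrict_apply, this, hBe]
    simp only [Subtype.mk.injEq]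
    by_cases hkl : k = l
    · subst hkl
      simp only [if_true]
      have h1 : (√(d k))⁻¹ * (√(d k))⁻¹ * d k = 1 := by
        rw [← mul_inv, Real.mul_self_sqrt (hd k), inv_mul_cancel₀ hk']
      exact_mod_cast h1
    · simp [hkl]
  obtain ⟨b, hb⟩ := hv.exists_orthonormalBasis_extension_of_card_eq (by simp)
  refine ⟨Matrix.of fun i k => b k i, ?_, star W, Unitary.star_mem hWu, fun k => √(d k), ?_⟩
  · rw [Matrix.mem_unitaryGroup_iff']
    ext k l
    have h := orthonormal_iff_ite.1 b.orthonormal k l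
    rw [PiLp.inner_apply] at h
    rw [Matrix.mul_apply, Matrix.one_apply, ← h]
    refine Finset.sum_congr rfl fun i _ => ?_
    simp [Matrix.star_apply, RCLike.inner_apply, mul_comm]
  · have h1 : B = (Matrix.of fun i k => b k i) * Matrix.diagonal (fun k => ((√(d k) : ℝ) : ℂ)) := by
      ext i k
      rw [Matrix.mul_diagonal, Matrix.of_apply]
      -- At a zero eigenvalue the column of B vanishes, so the basis vector chosen by the extension
      -- does not matter.
      by_cases hk : d k = 0
      · have h := hBe k k
        rw [if_pos rfl, hk] at h
        have h2 : ∑ i, Complex.normSq (B i k) = 0 := by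
          have : ((∑ i, Complex.normSq (B i k) : ℝ) : ℂ) = 0 := by
            rw [← Complex.ofReal_zero, ← h]; push_cast
            exact Finset.sum_congr rfl fun q _ => by rw [← Complex.mul_conj, mul_comm]; rfl
          exact_mod_cast this
        have h3 := (Finset.sum_eq_zero_iff_of_nonneg
          (fun i _ => Complex.normSq_nonneg (B i k))).1 h2 i (Finset.mem_univ _)
        rw [Complex.normSq_eq_zero.1 h3, hk]
        simp
      · rw [hb k hk]
        have hs : √(d k) ≠ 0 := fun h => hk ((Real.sqrt_eq_zero (hd k)).1 h)
        simp only [v, mul_assoc]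
        rw [← Complex.ofReal_mul, inv_mul_cancel₀ hs]
        simp
    rw [← h1, hB, mul_assoc, Matrix.mem_unitaryGroup_iff.1 hWu, mul_one]

/-! ### The form `∑ s k * s l * ρ (k, l) (l, k)` and its eigenvalues -/

/-- The eigenvalues `s i ^ 2`, `± s i * s j` of the partial transpose of the pure state with
Schmidt coefficients `s`. -/
def schmidtEigenvalue (s : Fin 3 → ℝ) (p : Fin 3 × Fin 3) : ℝ :=
  if p.1 ≤ p.2 then s p.1 * s p.2 else -(s p.1 * s p.2)

/-- The expectation of the partial transpose of `ρ` in the state with Schmidt coefficients `s`. -/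
def schmidtForm (s : Fin 3 → ℝ) (ρ : BipartiteMatrix 3 3) : ℂ :=
  ∑ k, ∑ l, (s k : ℂ) * s l * ρ (k, l) (l, k)

/-- The flip operator weighted by the products of the Schmidt coefficients. -/
def weightedFlip (s : Fin 3 → ℝ) : BipartiteMatrix 3 3 :=
  Matrix.of fun p q => if p = q.swap then (s q.1 : ℂ) * s q.2 else 0

/-- The orthonormal basis `e i ⊗ e i`, `(e i ⊗ e j ± e j ⊗ e i) / √2`. -/
noncomputable def flipBasis : BipartiteMatrix 3 3 :=
  Matrix.of fun p q =>
    if q.1 = q.2 then (if p = q then 1 else 0)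
    else if p = q then ((√2)⁻¹ : ℝ)
    else if p = q.swap then (if q.1 < q.2 then ((√2)⁻¹ : ℝ) else -((√2)⁻¹ : ℝ))
    else 0

lemma flipBasis_mem_unitaryGroup : flipBasis ∈ Matrix.unitaryGroup (Fin 3 × Fin 3) ℂ := by
  have h2 : (((√2)⁻¹ : ℝ) : ℂ) * ((√2)⁻¹ : ℝ) = 1 / 2 := by
    rw [← Complex.ofReal_mul, ← mul_inv, Real.mul_self_sqrt (by norm_num)]; norm_num
  rw [Matrix.mem_unitaryGroup_iff']
  ext ⟨i, j⟩ ⟨k, l⟩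
  simp only [Matrix.mul_apply, Fintype.sum_prod_type, Fin.sum_univ_three, Matrix.star_apply,
    flipBasis, Matrix.of_apply, Matrix.one_apply]
  have h3 : star (((√2)⁻¹ : ℝ) : ℂ) = ((√2)⁻¹ : ℝ) := Complex.conj_ofReal _
  generalize (((√2)⁻¹ : ℝ) : ℂ) = r at *
  fin_cases k <;> fin_cases l <;> fin_cases i <;> fin_cases j <;>
    simp [-Complex.star_def, h3, h2] <;> norm_num

/-- `weightedFlip s` is the partial transpose of the projector on ∑ s k • e k ⊗ e k. It preserves
each line e i ⊗ e i and each plane spanned by e i ⊗ e j and e j ⊗ e i, so one basis diagonalises it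
for all s. -/
lemma weightedFlip_mul_flipBasis (s : Fin 3 → ℝ) :
    weightedFlip s * flipBasis
      = flipBasis * Matrix.diagonal (fun p => (schmidtEigenvalue s p : ℂ)) := by
  ext ⟨i, j⟩ ⟨k, l⟩
  rw [Matrix.mul_diagonal, Matrix.mul_apply, Finset.sum_eq_single (j, i)]
  · simp only [weightedFlip, flipBasis, schmidtEigenvalue, Matrix.of_apply, Prod.swap_prod_mk,
      if_true]
    generalize (((√2)⁻¹ : ℝ) : ℂ) = r
    fin_cases k <;> fin_cases l <;> fin_cases i <;> fin_cases j <;> simp <;> ring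
  · rintro ⟨k, l⟩ - h
    rw [weightedFlip, Matrix.of_apply, if_neg, zero_mul]
    rintro h'
    apply h
    simp_all
  · simp

lemma schmidtForm_eq_trace (s : Fin 3 → ℝ) (ρ : BipartiteMatrix 3 3) :
    schmidtForm s ρ = (weightedFlip s * ρ).trace := by
  simp only [schmidtForm, Matrix.trace, Matrix.diag, Fintype.sum_prod_type]
  rw [Finset.sum_comm]
  refine Finset.sum_congr rfl fun l _ => Finset.sum_congr rfl fun k _ => ?_
  rw [Matrix.mul_apply, Finset.sum_eq_single (k, l)]
  · simp [weightedFlip]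
  · rintro ⟨i, j⟩ - h
    rw [weightedFlip, Matrix.of_apply, if_neg, zero_mul]
    rintro h'
    apply h
    simp_all
  · simp

lemma schmidtForm_conj_flipBasis (s : Fin 3 → ℝ) (M : BipartiteMatrix 3 3) :
    schmidtForm s (flipBasis * M * star flipBasis) = ∑ p, (schmidtEigenvalue s p : ℂ) * M p p := by
  rw [schmidtForm_eq_trace, ← mul_assoc, ← mul_assoc, weightedFlip_mul_flipBasis,
    Matrix.trace_mul_comm, ← mul_assoc, ← mul_assoc,
    Matrix.mem_unitaryGroup_iff'.1 flipBasis_mem_unitaryGroup, one_mul]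
  simp [Matrix.trace, Matrix.diagonal_mul]

lemma schmidtForm_conj_diagonal (s : Fin 3 → ℝ) (T : BipartiteMatrix 3 3)
    (x : Fin 3 × Fin 3 → ℝ) :
    schmidtForm s (flipBasis * (T * Matrix.diagonal (fun p => (x p : ℂ)) * star T)
      * star flipBasis) =
      ((∑ p, schmidtEigenvalue s p * ∑ q, Complex.normSq (T p q) * x q : ℝ) : ℂ) := by
  rw [schmidtForm_conj_flipBasis]
  simp only [conj_diagonal_apply_self]
  push_cast
  rfl

lemma sum_six_comm {α β : Type*} [Fintype α] [AddCommMonoid β] (f : α → α → α → α → α → α → β) :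
    ∑ i, ∑ j, ∑ i', ∑ j', ∑ k, ∑ l, f k l i' j i j' =
      ∑ k, ∑ l, ∑ i', ∑ j, ∑ i, ∑ j', f k l i' j i j' := by
  let e : α × α × α × α × α × α ≃ α × α × α × α × α × α :=
    { toFun := fun p => (p.2.2.2.2.1, p.2.2.2.2.2, p.2.2.1, p.2.1, p.1, p.2.2.2.1)
      invFun := fun p => (p.2.2.2.2.1, p.2.2.2.1, p.2.2.1, p.2.2.2.2.2, p.1, p.2.1)
      left_inv := fun _ => rfl
      right_inv := fun _ => rfl }
  have h := e.sum_comp fun p => f p.1 p.2.1 p.2.2.1 p.2.2.2.1 p.2.2.2.2.1 p.2.2.2.2.2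
  simp only [Fintype.sum_prod_type] at h
  exact h

/-- A local unitary acting on ψ can be moved onto ρ, where the transposition of the second factor
conjugates its part there. This reduces a general ψ to its Schmidt form. -/
lemma star_dotProduct_partialTranspose_mulVec (ρ : BipartiteMatrix 3 3)
    (V W : Matrix (Fin 3) (Fin 3) ℂ) (s : Fin 3 → ℝ) (ψ : Fin 3 × Fin 3 → ℂ)
    (hψ : ∀ i j, ψ (i, j) = ∑ k, V i k * s k * W k j) :
    star ψ ⬝ᵥ (partialTranspose ρ).mulVec ψ =
      schmidtForm s (star (Matrix.kronecker V (star W)) * ρ * Matrix.kronecker V (star W)) := by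
  have hl : star ψ ⬝ᵥ (partialTranspose ρ).mulVec ψ =
      ∑ i, ∑ j, ∑ i', ∑ j', ∑ k, ∑ l, (s k : ℂ) * s l *
        (star (V i k) * W l j' * ρ (i, j') (i', j) * (V i' l * star (W k j))) := by
    simp only [dotProduct, Matrix.mulVec, Fintype.sum_prod_type, partialTranspose, Matrix.of_apply,
      Pi.star_apply]
    refine Finset.sum_congr rfl fun i _ => Finset.sum_congr rfl fun j _ => ?_
    rw [Finset.mul_sum]
    refine Finset.sum_congr rfl fun i' _ => ?_
    rw [Finset.mul_sum]
    refine Finset.sum_congr rfl fun j' _ => ?_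
    rw [hψ, hψ, star_sum, Finset.sum_mul]
    refine Finset.sum_congr rfl fun k _ => ?_
    rw [Finset.mul_sum, Finset.mul_sum]
    refine Finset.sum_congr rfl fun l _ => ?_
    simp only [star_mul', Complex.star_def, Complex.conj_ofReal]
    ring
  have hr : schmidtForm s
        (star (Matrix.kronecker V (star W)) * ρ * Matrix.kronecker V (star W)) =
      ∑ k, ∑ l, ∑ i', ∑ j, ∑ i, ∑ j', (s k : ℂ) * s l *
        (star (V i k) * W l j' * ρ (i, j') (i', j) * (V i' l * star (W k j))) := by
    simp only [schmidtForm, Matrix.mul_apply, Fintype.sum_prod_type, Matrix.star_apply,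
      Matrix.kronecker, Matrix.kroneckerMap_apply, star_mul', star_star, Finset.mul_sum,
      Finset.sum_mul]
  rw [hl, hr]
  exact sum_six_comm _

/-! ### The spectral criterion -/

lemma unitary_conj_mem {n : Type*} [Fintype n] [DecidableEq n] {U V : Matrix n n ℂ}
    (hU : U ∈ Matrix.unitaryGroup n ℂ) (hV : V ∈ Matrix.unitaryGroup n ℂ) :
    star U * V ∈ Matrix.unitaryGroup n ℂ :=
  mul_mem (Unitary.star_mem hU) hV

lemma isState_conj {x : Fin 3 × Fin 3 → ℝ} (h0 : ∀ p, 0 ≤ x p) (h1 : ∑ p, x p = 1)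
    {U : BipartiteMatrix 3 3} (hU : U ∈ Matrix.unitaryGroup (Fin 3 × Fin 3) ℂ) :
    IsState (U * Matrix.diagonal (fun p => (x p : ℂ)) * star U) := by
  constructor
  · refine Matrix.PosSemidef.mul_mul_conjTranspose_same (Matrix.PosSemidef.diagonal ?_) U
    intro p
    simpa using h0 p
  · rw [Matrix.trace_mul_cycle, Matrix.mem_unitaryGroup_iff'.1 hU, one_mul, Matrix.trace_diagonal]
    exact_mod_cast h1

lemma isHermitian_partialTranspose {m n : ℕ} {ρ : BipartiteMatrix m n} (h : ρ.IsHermitian) :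
    (partialTranspose ρ).IsHermitian := by
  ext p q
  exact h.apply _ _

/-- The spectral criterion for absolutely PPT states: the pairings of the spectrum with the
eigenvalues of the partial transposes of the pure states are nonnegative. -/
def SpectralCriterion (x : Fin 3 × Fin 3 → ℝ) : Prop :=
  ∑ p, x p = 1 ∧ ∀ (s : Fin 3 → ℝ) (σ : Equiv.Perm (Fin 3 × Fin 3)),
    0 ≤ ∑ p, schmidtEigenvalue s p * x (σ p)

lemma SpectralCriterion.nonneg {x : Fin 3 × Fin 3 → ℝ} (h : SpectralCriterion x)
    (p : Fin 3 × Fin 3) : 0 ≤ x p := by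
  -- A product vector has the single nonzero eigenvalue s 0 ^ 2 = 1, located at (0, 0).
  have h1 := h.2 (Pi.single 0 1) (Equiv.swap (0, 0) p)
  rw [Finset.sum_eq_single (0, 0)] at h1
  · simpa [schmidtEigenvalue] using h1
  · rintro ⟨i, j⟩ - hij
    have : (Pi.single 0 1 : Fin 3 → ℝ) i * (Pi.single 0 1 : Fin 3 → ℝ) j = 0 := by
      by_cases hi : i = 0
      · have hj : j ≠ 0 := by rintro rfl; exact hij (by rw [hi])
        simp [hj]
      · simp [hi]
    simp [schmidtEigenvalue, this]
  · simp

/-- The criterion is a family of linear conditions that is invariant under permutations of the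
spectrum. -/
lemma SpectralCriterion.of_mem_convexHull {x z : Fin 3 × Fin 3 → ℝ} (h : SpectralCriterion x)
    (hz : z ∈ convexHull ℝ (Set.range fun σ : Equiv.Perm (Fin 3 × Fin 3) => x ∘ σ)) :
    SpectralCriterion z := by
  have hc : Convex ℝ {z | SpectralCriterion z} := by
    rintro y ⟨hy1, hy2⟩ z ⟨hz1, hz2⟩ a b ha hb hab
    constructor
    · simp only [Pi.add_apply, Pi.smul_apply, smul_eq_mul, Finset.sum_add_distrib,
        ← Finset.mul_sum, hy1, hz1, mul_one, hab]
    · intro s σ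
      have h := add_nonneg (mul_nonneg ha (hy2 s σ)) (mul_nonneg hb (hz2 s σ))
      rw [Finset.mul_sum, Finset.mul_sum, ← Finset.sum_add_distrib] at h
      refine h.trans_eq (Finset.sum_congr rfl fun p _ => ?_)
      simp only [Pi.add_apply, Pi.smul_apply, smul_eq_mul]
      ring
  refine convexHull_min ?_ hc hz
  rintro _ ⟨σ, rfl⟩
  refine ⟨?_, fun s τ => ?_⟩
  · rw [← h.1]; exact Equiv.sum_comp σ x
  · exact h.2 s (τ.trans σ)

lemma SpectralCriterion.isPPT {x : Fin 3 × Fin 3 → ℝ} (h : SpectralCriterion x)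
    {U : BipartiteMatrix 3 3} (hU : U ∈ Matrix.unitaryGroup (Fin 3 × Fin 3) ℂ) :
    IsPPT (U * Matrix.diagonal (fun p => (x p : ℂ)) * star U) := by
  have hst := isState_conj h.nonneg h.1 hU
  refine ⟨hst, ?_⟩
  rw [Matrix.posSemidef_iff_dotProduct_mulVec]
  refine ⟨isHermitian_partialTranspose hst.1.isHermitian, fun ψ => ?_⟩
  obtain ⟨V, hV, W, hW, s, hs⟩ := Matrix.exists_svd (Matrix.of fun i j => ψ (i, j))
  rw [star_dotProduct_partialTranspose_mulVec _ V W s]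
  · set Z : BipartiteMatrix 3 3 := Matrix.kronecker V (star W) with hZ
    have hZu : Z ∈ Matrix.unitaryGroup (Fin 3 × Fin 3) ℂ :=
      Matrix.kronecker_mem_unitary hV (Unitary.star_mem hW)
    set T : BipartiteMatrix 3 3 := star flipBasis * (star Z * U) with hT
    have hTu : T ∈ Matrix.unitaryGroup (Fin 3 × Fin 3) ℂ :=
      unitary_conj_mem flipBasis_mem_unitaryGroup (unitary_conj_mem hZu hU)
    have hR := Matrix.mem_unitaryGroup_iff.1 flipBasis_mem_unitaryGroup
    have hk : star Z * (U * Matrix.diagonal (fun p => (x p : ℂ)) * star U) * Z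
        = flipBasis * (T * Matrix.diagonal (fun p => (x p : ℂ)) * star T) * star flipBasis := by
      simp only [hT, star_mul, star_star, ← mul_assoc, hR, one_mul]
      simp only [mul_assoc, hR, mul_one]
    rw [hk, schmidtForm_conj_diagonal]
    have h2 := (h.of_mem_convexHull (sum_normSq_mem_convexHull hTu x)).2 s 1
    exact_mod_cast h2
  · intro i j
    have := congrFun (congrFun hs i) j
    rw [Matrix.of_apply] at this
    rw [this, Matrix.mul_apply]
    simp [Matrix.mul_diagonal]

lemma star_dotProduct_partialTranspose_mulVec_diagonal (ρ : BipartiteMatrix 3 3)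
    (s : Fin 3 → ℝ) :
    star (fun p : Fin 3 × Fin 3 => if p.1 = p.2 then (s p.1 : ℂ) else 0) ⬝ᵥ
      (partialTranspose ρ).mulVec (fun p => if p.1 = p.2 then (s p.1 : ℂ) else 0)
      = schmidtForm s ρ := by
  rw [star_dotProduct_partialTranspose_mulVec _ 1 1 s]
  · simp [Matrix.kronecker]
  · intro i j
    simp only [Matrix.one_apply, ite_mul, one_mul, zero_mul, mul_ite, mul_one, mul_zero,
      Finset.sum_ite_eq', Finset.mem_univ, if_true]
    split_ifs with hij
    · rw [hij]
    · rfl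

theorem spectralCriterion_of_isPPT {x : Fin 3 × Fin 3 → ℝ}
    (h : ∀ U ∈ Matrix.unitaryGroup (Fin 3 × Fin 3) ℂ,
      IsPPT (U * Matrix.diagonal (fun p => (x p : ℂ)) * star U)) :
    SpectralCriterion x := by
  constructor
  · have h1 := (h 1 (one_mem _)).1.2
    simp only [one_mul, star_one, mul_one, Matrix.trace_diagonal] at h1
    exact_mod_cast h1
  · intro s σ
    -- The permutation matrix of σ, followed by the change to `flipBasis`, aligns the spectrum with
    -- the eigenvalues in the order σ. The vector ∑ s k • e k ⊗ e k then tests exactly this pairing.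
    let T : BipartiteMatrix 3 3 := (1 : BipartiteMatrix 3 3).submatrix σ id
    have hT : T ∈ Matrix.unitaryGroup (Fin 3 × Fin 3) ℂ := by
      rw [Matrix.mem_unitaryGroup_iff]
      ext p q
      simp [T, Matrix.mul_apply, Matrix.one_apply]
    have h1 := (Matrix.posSemidef_iff_dotProduct_mulVec.1
      (h (flipBasis * T) (mul_mem flipBasis_mem_unitaryGroup hT)).2).2
      (fun p => if p.1 = p.2 then (s p.1 : ℂ) else 0)
    rw [star_dotProduct_partialTranspose_mulVec_diagonal] at h1
    have hk : flipBasis * T * Matrix.diagonal (fun p => (x p : ℂ)) * star (flipBasis * T)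
        = flipBasis * (T * Matrix.diagonal (fun p => (x p : ℂ)) * star T) * star flipBasis := by
      simp only [star_mul, mul_assoc]
    rw [hk, schmidtForm_conj_diagonal] at h1
    have h2 : (0 : ℝ) ≤ ∑ p, schmidtEigenvalue s p * ∑ q, Complex.normSq (T p q) * x q := by
      exact_mod_cast h1
    convert h2 using 3 with p
    simp [T, Matrix.one_apply, apply_ite Complex.normSq]

lemma mem_absolutelyPPT_of_conj {x : Fin 3 × Fin 3 → ℝ} (h : SpectralCriterion x)
    {W : BipartiteMatrix 3 3} (hW : W ∈ Matrix.unitaryGroup (Fin 3 × Fin 3) ℂ) :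
    W * Matrix.diagonal (fun p => (x p : ℂ)) * star W ∈ absolutelyPPT 3 3 := by
  refine ⟨h.isPPT hW, fun U hU => ?_⟩
  have := h.isPPT (mul_mem hU hW)
  simpa only [star_mul, mul_assoc] using this

theorem diagonal_mem_absolutelyPPT_iff {x : Fin 3 × Fin 3 → ℝ} :
    Matrix.diagonal (fun p => (x p : ℂ)) ∈ absolutelyPPT 3 3 ↔ SpectralCriterion x := by
  refine ⟨fun h => spectralCriterion_of_isPPT h.2, fun h => ?_⟩
  simpa using mem_absolutelyPPT_of_conj h (one_mem _)

/-- An absolutely PPT state, with its spectral decomposition. -/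
lemma exists_spectral_of_mem_absolutelyPPT {X : BipartiteMatrix 3 3}
    (hX : X ∈ absolutelyPPT 3 3) :
    ∃ W ∈ Matrix.unitaryGroup (Fin 3 × Fin 3) ℂ, ∃ y, SpectralCriterion y ∧
      X = W * Matrix.diagonal (fun p => (y p : ℂ)) * star W := by
  have hH := hX.1.1.1.isHermitian
  have hs : X = (hH.eigenvectorUnitary : BipartiteMatrix 3 3) *
      Matrix.diagonal (fun p => (hH.eigenvalues p : ℂ)) *
      star (hH.eigenvectorUnitary : BipartiteMatrix 3 3) := by
    have := hH.spectral_theorem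
    rw [Unitary.conjStarAlgAut_apply] at this
    exact this
  set W := (hH.eigenvectorUnitary : BipartiteMatrix 3 3) with hW
  have hWu : W ∈ Matrix.unitaryGroup (Fin 3 × Fin 3) ℂ := hH.eigenvectorUnitary.2
  refine ⟨W, hWu, hH.eigenvalues, spectralCriterion_of_isPPT fun U hU => ?_, hs⟩
  have h := hX.2 (U * star W) (mul_mem hU (Unitary.star_mem hWu))
  rw [hs] at h
  have hWW := Matrix.mem_unitaryGroup_iff'.1 hWu
  convert h using 1
  simp only [star_mul, star_star, mul_assoc]
  rw [← mul_assoc (star W) W, hWW, one_mul, ← mul_assoc (star W) W, hWW, one_mul]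

/-! ### Extreme points -/

/-- The squared Frobenius norm of X is ∑ y p ^ 2. If the diagonal alone already accounts for it,
every off-diagonal entry is zero. -/
lemma eq_diagonal_of_normSq {X W : BipartiteMatrix 3 3} {y z : Fin 3 × Fin 3 → ℝ}
    (hW : W ∈ Matrix.unitaryGroup (Fin 3 × Fin 3) ℂ)
    (hX : X = W * Matrix.diagonal (fun p => (y p : ℂ)) * star W)
    (hz : ∀ p, X p p = z p) (hy : ∑ p, y p ^ 2 = ∑ p, z p ^ 2) :
    X = Matrix.diagonal (fun p => (z p : ℂ)) := by
  have hWW := Matrix.mem_unitaryGroup_iff'.1 hW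
  have h1 : (X * star X).trace = ((∑ p, y p ^ 2 : ℝ) : ℂ) := by
    have hst : star (Matrix.diagonal (fun p => (y p : ℂ))) = Matrix.diagonal (fun p => (y p : ℂ)) := by
      rw [Matrix.star_eq_conjTranspose, Matrix.diagonal_conjTranspose]
      congr 1; ext p; simp
    rw [hX, star_mul, star_mul, star_star, hst]
    simp only [mul_assoc]
    rw [← mul_assoc (star W) W, hWW, one_mul, Matrix.trace_mul_comm]
    simp only [mul_assoc, hWW, mul_one]
    rw [Matrix.diagonal_mul_diagonal, Matrix.trace_diagonal]
    push_cast
    exact Finset.sum_congr rfl fun p _ => by ring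
  have h2 : (X * star X).trace = ((∑ p, ∑ q, Complex.normSq (X p q) : ℝ) : ℂ) := by
    simp only [Matrix.trace, Matrix.diag, Matrix.mul_apply]
    push_cast
    exact Finset.sum_congr rfl fun p _ => Finset.sum_congr rfl fun q _ => by
      rw [← Complex.mul_conj]; rfl
  have h3 : ∑ p, ∑ q, Complex.normSq (X p q) = ∑ p, Complex.normSq (X p p) := by
    have : ∑ p, ∑ q, Complex.normSq (X p q) = ∑ p, y p ^ 2 := by exact_mod_cast h2.symm.trans h1
    rw [this, hy]
    exact Finset.sum_congr rfl fun p _ => by rw [hz, Complex.normSq_ofReal]; ring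
  have h4 : ∀ p, Complex.normSq (X p p) ≤ ∑ q, Complex.normSq (X p q) := fun p =>
    Finset.single_le_sum (f := fun q => Complex.normSq (X p q))
      (fun q _ => Complex.normSq_nonneg _) (Finset.mem_univ p)
  have h5 := (Finset.sum_eq_sum_iff_of_le fun p _ => h4 p).1 h3.symm
  ext p q
  by_cases hpq : p = q
  · subst hpq; rw [hz, Matrix.diagonal_apply_eq]
  · rw [Matrix.diagonal_apply_ne _ hpq]
    have h6 := h5 p (Finset.mem_univ _)
    rw [← Finset.add_sum_erase _ _ (Finset.mem_univ p)] at h6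
    have h7 : ∑ q ∈ Finset.univ.erase p, Complex.normSq (X p q) = 0 := by linarith
    rw [Finset.sum_eq_zero_iff_of_nonneg fun _ _ => Complex.normSq_nonneg _] at h7
    exact Complex.normSq_eq_zero.1 (h7 q (Finset.mem_erase.2 ⟨Ne.symm hpq, Finset.mem_univ _⟩))

/-- If diag z lies between X and Y, their diagonals satisfy the criterion by Schur's theorem, so
extremality of z makes both equal to z. Then z is also extreme in the hull of the permutations of
the spectrum of X, hence is one of these permutations, and X has the Frobenius norm of its diagonal.
-/
lemma diagonal_mem_extremePoints {z : Fin 3 × Fin 3 → ℝ}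
    (hz : z ∈ Set.extremePoints ℝ {z | SpectralCriterion z}) :
    Matrix.diagonal (fun p => (z p : ℂ)) ∈ Set.extremePoints ℝ (absolutelyPPT 3 3) := by
  rw [mem_extremePoints_iff_left]
  refine ⟨diagonal_mem_absolutelyPPT_iff.2 hz.1, ?_⟩
  rintro X hX Y hY ⟨a, b, ha, hb, hab, h⟩
  obtain ⟨W, hW, y, hy, rfl⟩ := exists_spectral_of_mem_absolutelyPPT hX
  obtain ⟨W', hW', y', hy', rfl⟩ := exists_spectral_of_mem_absolutelyPPT hY
  have hu := sum_normSq_mem_convexHull hW y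
  have hu' := sum_normSq_mem_convexHull hW' y'
  have hd := conj_diagonal_apply_self W y
  have hd' := conj_diagonal_apply_self W' y'
  set u := fun p => ∑ q, Complex.normSq (W p q) * y q with hudef
  set u' := fun p => ∑ q, Complex.normSq (W' p q) * y' q
  have huz : u = z := by
    refine (mem_extremePoints_iff_left.1 hz).2 u (hy.of_mem_convexHull hu) u'
      (hy'.of_mem_convexHull hu') ⟨a, b, ha, hb, hab, ?_⟩
    ext p
    have hp := congrFun (congrFun h p) p
    rw [Matrix.add_apply, Matrix.smul_apply, Matrix.smul_apply, hd, hd',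
      Matrix.diagonal_apply_eq] at hp
    simp only [Complex.real_smul] at hp
    exact_mod_cast hp
  rw [huz] at hu
  have hext : z ∈ Set.range fun σ : Equiv.Perm (Fin 3 × Fin 3) => y ∘ σ := by
    refine extremePoints_convexHull_subset (𝕜 := ℝ)
      (inter_extremePoints_subset_extremePoints_of_subset ?_ ⟨hu, hz⟩)
    exact fun w hw => hy.of_mem_convexHull hw
  obtain ⟨σ, rfl⟩ := hext
  refine eq_diagonal_of_normSq hW rfl (fun p => ?_) ?_
  · rw [hd]; exact congrArg _ (congrFun huz p)
  · exact (Equiv.sum_comp σ fun p => y p ^ 2).symm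

/-- The eigenvalues `s i ^ 2`, `± s i * s j`, listed in ascending order for
`s 0 ≥ s 1 ≥ s 2 ≥ 0` and `s 0 * s 2 ≥ s 1 ^ 2`. -/
def sortedEigenvalue (s : Fin 3 → ℝ) : Fin 9 → ℝ :=
  ![-(s 0 * s 1), -(s 0 * s 2), -(s 1 * s 2), s 2 * s 2, s 1 * s 2, s 1 * s 1, s 0 * s 2,
    s 0 * s 1, s 0 * s 0]

/-- The spectra of the absolutely PPT two-qutrit states. -/
def pptSpectra : Set (Fin 9 → ℝ) :=
  {x | ∑ i, x i = 1 ∧ ∀ (s : Fin 3 → ℝ) (σ : Equiv.Perm (Fin 9)),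
    0 ≤ ∑ i, sortedEigenvalue s i * x (σ i)}

lemma exists_equiv_sortedEigenvalue :
    ∃ e : Fin 9 ≃ Fin 3 × Fin 3, ∀ s i, schmidtEigenvalue s (e i) = sortedEigenvalue s i := by
  refine ⟨Equiv.ofBijective
    (![(1, 0), (2, 0), (2, 1), (2, 2), (1, 2), (1, 1), (0, 2), (0, 1), (0, 0)] :
      Fin 9 → Fin 3 × Fin 3) ?_, ?_⟩
  · rw [Fintype.bijective_iff_injective_and_card]
    exact ⟨by decide, by simp⟩
  · intro s i
    fin_cases i <;> simp [schmidtEigenvalue, sortedEigenvalue] <;> ring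

lemma spectralCriterion_comp_iff (f : Fin 3 × Fin 3 ≃ Fin 9) (x : Fin 9 → ℝ) :
    SpectralCriterion (x ∘ f) ↔ x ∈ pptSpectra := by
  obtain ⟨e, he⟩ := exists_equiv_sortedEigenvalue
  refine and_congr (by rw [← Equiv.sum_comp f x]; rfl) (forall_congr' fun s => ?_)
  constructor
  · intro h σ
    have h1 := h (e.symm.trans (σ.trans f.symm))
    rw [← Equiv.sum_comp e] at h1
    simpa [he] using h1
  · intro h σ
    have h1 := h (e.trans (σ.trans f))
    rw [← Equiv.sum_comp e]
    simpa [he] using h1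

lemma diag9_mem_absolutelyPPT_iff {x : Fin 9 → ℝ} :
    diag9 x ∈ absolutelyPPT 3 3 ↔ x ∈ pptSpectra :=
  diagonal_mem_absolutelyPPT_iff.trans (spectralCriterion_comp_iff finProdFinEquiv x)

lemma diag9_injective : Function.Injective diag9 := by
  intro x y h
  ext i
  have h1 := congrFun (congrFun h (finProdFinEquiv.symm i)) (finProdFinEquiv.symm i)
  simp only [diag9, Matrix.diagonal_apply_eq, Equiv.apply_symm_apply] at h1
  exact_mod_cast h1

lemma diag9_add_smul (a b : ℝ) (x y : Fin 9 → ℝ) :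
    diag9 (a • x + b • y) = a • diag9 x + b • diag9 y := by
  ext p q
  by_cases h : p = q
  · subst h; simp [diag9]
  · simp [diag9, h]

theorem diag9_mem_extremePoints_iff {x : Fin 9 → ℝ} :
    diag9 x ∈ Set.extremePoints ℝ (absolutelyPPT 3 3) ↔ x ∈ Set.extremePoints ℝ pptSpectra := by
  constructor
  · intro h
    rw [mem_extremePoints_iff_left] at h ⊢
    refine ⟨diag9_mem_absolutelyPPT_iff.1 h.1, ?_⟩
    rintro y hy z hz ⟨a, b, ha, hb, hab, rfl⟩
    exact diag9_injective (h.2 _ (diag9_mem_absolutelyPPT_iff.2 hy) _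
      (diag9_mem_absolutelyPPT_iff.2 hz) ⟨a, b, ha, hb, hab, (diag9_add_smul a b y z).symm⟩)
  · intro h
    refine diagonal_mem_extremePoints (z := x ∘ finProdFinEquiv) ?_
    rw [mem_extremePoints_iff_left] at h ⊢
    refine ⟨(spectralCriterion_comp_iff _ x).2 h.1, ?_⟩
    rintro y hy z hz ⟨a, b, ha, hb, hab, hx⟩
    have key : ∀ y : Fin 3 × Fin 3 → ℝ, SpectralCriterion y →
        y ∘ finProdFinEquiv.symm ∈ pptSpectra := by
      intro y hy
      rw [← spectralCriterion_comp_iff finProdFinEquiv]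
      convert hy
      ext p; simp
    have h2 := h.2 _ (key y hy) _ (key z hz) ⟨a, b, ha, hb, hab, ?_⟩
    · rw [← h2]; ext p; simp
    · ext i
      have := congrFun hx (finProdFinEquiv.symm i)
      simpa using this

/-! ### The quadratic forms attached to a spectrum -/

/-- The pairing of a vector with `sortedEigenvalue s`, as a quadratic form in `s`. -/
def pairingForm (x : Fin 9 → ℝ) (s : Fin 3 → ℝ) : ℝ :=
  x 8 * s 0 ^ 2 + x 5 * s 1 ^ 2 + x 3 * s 2 ^ 2 + (x 7 - x 0) * (s 0 * s 1)
    + (x 6 - x 1) * (s 0 * s 2) + (x 4 - x 2) * (s 1 * s 2)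

lemma sum_sortedEigenvalue_mul (x : Fin 9 → ℝ) (s : Fin 3 → ℝ) :
    ∑ i, sortedEigenvalue s i * x i = pairingForm x s := by
  simp only [Fin.sum_univ_succ, sortedEigenvalue, pairingForm]
  simp
  ring!

lemma mem_pptSpectra_iff {x : Fin 9 → ℝ} : x ∈ pptSpectra ↔
    ∑ i, x i = 1 ∧ ∀ s (σ : Equiv.Perm (Fin 9)), 0 ≤ pairingForm (x ∘ σ) s := by
  simp only [← sum_sortedEigenvalue_mul]
  rfl

/-- Exchanging two Schmidt coefficients, or changing the sign of one, only permutes the eigenvalues,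
so it preserves the condition over all σ. -/
lemma pairingForm_nonneg_of_perm {x : Fin 9 → ℝ} {s t : Fin 3 → ℝ}
    (h : ∀ σ : Equiv.Perm (Fin 9), 0 ≤ pairingForm (x ∘ σ) s)
    (τ : Equiv.Perm (Fin 9)) (hτ : ∀ i, sortedEigenvalue t i = sortedEigenvalue s (τ i))
    (σ : Equiv.Perm (Fin 9)) : 0 ≤ pairingForm (x ∘ σ) t := by
  have h1 := h (τ.symm.trans σ)
  rw [← sum_sortedEigenvalue_mul, ← Equiv.sum_comp τ] at h1
  rw [← sum_sortedEigenvalue_mul]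
  simpa [hτ] using h1

lemma pairingForm_nonneg_of_sorted {x : Fin 9 → ℝ}
    (h : ∀ u v w : ℝ, 0 ≤ w → w ≤ v → v ≤ u →
      ∀ σ : Equiv.Perm (Fin 9), 0 ≤ pairingForm (x ∘ σ) ![u, v, w])
    (s : Fin 3 → ℝ) (σ : Equiv.Perm (Fin 9)) : 0 ≤ pairingForm (x ∘ σ) s := by
  have swap01 : ∀ u v w : ℝ, (∀ σ : Equiv.Perm (Fin 9), 0 ≤ pairingForm (x ∘ σ) ![u, v, w]) →
      ∀ σ : Equiv.Perm (Fin 9), 0 ≤ pairingForm (x ∘ σ) ![v, u, w] := by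
    intro u v w h
    refine pairingForm_nonneg_of_perm h
      (Equiv.swap 1 2 * Equiv.swap 5 8 * Equiv.swap 4 6) fun i => ?_
    fin_cases i <;> simp [sortedEigenvalue, Equiv.swap_apply_def, mul_comm]
  have swap12 : ∀ u v w : ℝ, (∀ σ : Equiv.Perm (Fin 9), 0 ≤ pairingForm (x ∘ σ) ![u, v, w]) →
      ∀ σ : Equiv.Perm (Fin 9), 0 ≤ pairingForm (x ∘ σ) ![u, w, v] := by
    intro u v w h
    refine pairingForm_nonneg_of_perm h
      (Equiv.swap 0 1 * Equiv.swap 3 5 * Equiv.swap 6 7) fun i => ?_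
    fin_cases i <;> simp [sortedEigenvalue, Equiv.swap_apply_def, mul_comm]
  have neg0 : ∀ u v w : ℝ, (∀ σ : Equiv.Perm (Fin 9), 0 ≤ pairingForm (x ∘ σ) ![u, v, w]) →
      ∀ σ : Equiv.Perm (Fin 9), 0 ≤ pairingForm (x ∘ σ) ![-u, v, w] := by
    intro u v w h
    refine pairingForm_nonneg_of_perm h (Equiv.swap 0 7 * Equiv.swap 1 6) fun i => ?_
    fin_cases i <;> simp [sortedEigenvalue, Equiv.swap_apply_def]
  have nonneg : ∀ u v w : ℝ, 0 ≤ u → 0 ≤ v → 0 ≤ w →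
      ∀ σ : Equiv.Perm (Fin 9), 0 ≤ pairingForm (x ∘ σ) ![u, v, w] := by
    intro u v w hu hv hw
    rcases le_total u v with h1 | h1 <;> rcases le_total v w with h2 | h2 <;>
      rcases le_total u w with h3 | h3
    · exact swap12 _ _ _ (swap01 _ _ _ (swap12 _ _ _ (h w v u hu h1 h2)))
    · exact swap12 _ _ _ (swap01 _ _ _ (swap12 _ _ _ (h w v u hu h1 h2)))
    · exact swap01 _ _ _ (swap12 _ _ _ (h v w u hu h3 h2))
    · exact swap01 _ _ _ (h v u w hw h3 h1)
    · exact swap12 _ _ _ (swap01 _ _ _ (h w u v hv h1 h3))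
    · exact swap12 _ _ _ (h u w v hv h2 h3)
    · exact h u v w hw h2 h1
    · exact h u v w hw h2 h1
  have abs0 : ∀ u v w : ℝ, (∀ σ : Equiv.Perm (Fin 9), 0 ≤ pairingForm (x ∘ σ) ![|u|, v, w]) →
      ∀ σ : Equiv.Perm (Fin 9), 0 ≤ pairingForm (x ∘ σ) ![u, v, w] := by
    intro u v w h
    rcases abs_choice u with hu | hu
    · rwa [hu] at h
    · rw [hu] at h
      simpa using neg0 _ _ _ h
  have hs : s = ![s 0, s 1, s 2] := by ext i; fin_cases i <;> rfl
  rw [hs]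
  refine abs0 _ _ _ (swap01 _ _ _ (abs0 _ _ _ (swap12 _ _ _ (swap01 _ _ _ (abs0 _ _ _ ?_))))) σ
  exact nonneg _ _ _ (abs_nonneg _) (abs_nonneg _) (abs_nonneg _)

lemma monotone_fin9 {f : Fin 9 → ℝ} (h0 : f 0 ≤ f 1) (h1 : f 1 ≤ f 2) (h2 : f 2 ≤ f 3)
    (h3 : f 3 ≤ f 4) (h4 : f 4 ≤ f 5) (h5 : f 5 ≤ f 6) (h6 : f 6 ≤ f 7) (h7 : f 7 ≤ f 8) :
    Monotone f := by
  rw [Fin.monotone_iff_le_succ]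
  intro i
  fin_cases i <;> assumption

lemma mem_pptSpectra_of_antitone {x : Fin 9 → ℝ} (hx : Antitone x) (hsum : ∑ i, x i = 1)
    (h1 : ∀ u v w : ℝ, 0 ≤ w → w ≤ v → v ≤ u → 0 ≤ pairingForm x ![u, v, w])
    (h2 : ∀ u v w : ℝ, 0 ≤ w → w ≤ v → v ≤ u →
      0 ≤ pairingForm (x ∘ Equiv.swap 5 6) ![u, v, w]) :
    x ∈ pptSpectra := by
  rw [mem_pptSpectra_iff]
  refine ⟨hsum, pairingForm_nonneg_of_sorted fun u v w hw hwv hvu σ => ?_⟩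
  have hv := hw.trans hwv
  have hu := hv.trans hvu
  -- For u ≥ v ≥ w ≥ 0 the only undetermined comparison among the eigenvalues is v² against uw.
  -- Pairing increasing eigenvalues with decreasing entries gives the minimum over σ.
  rcases le_total (v * v) (u * w) with h | h
  · have hm : Monotone (sortedEigenvalue ![u, v, w]) := by
      apply monotone_fin9 <;> simp [sortedEigenvalue] <;> first | assumption | nlinarith
    have := (hm.antivary hx).sum_mul_le_sum_mul_comp_perm (σ := σ)
    rw [sum_sortedEigenvalue_mul] at this
    refine (h1 u v w hw hwv hvu).trans (this.trans_eq ?_)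
    rw [← sum_sortedEigenvalue_mul]; rfl
  · have hm : Monotone (sortedEigenvalue ![u, v, w] ∘ Equiv.swap 5 6) := by
      apply monotone_fin9 <;> simp [sortedEigenvalue, Equiv.swap_apply_def] <;>
        first | assumption | nlinarith
    have := (hm.antivary hx).sum_mul_le_sum_mul_comp_perm (σ := (Equiv.swap 5 6).trans σ)
    refine (h2 u v w hw hwv hvu).trans (le_of_eq_of_le ?_ (this.trans_eq ?_))
    · rw [← sum_sortedEigenvalue_mul, ← Equiv.sum_comp (Equiv.swap (5 : Fin 9) 6)]
      simp
    · rw [← sum_sortedEigenvalue_mul, ← Equiv.sum_comp (Equiv.swap (5 : Fin 9) 6)]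
      simp

lemma eq_zero_of_quadratic_nonneg {g A : ℝ} (h : ∀ t : ℝ, 0 ≤ t * g + t ^ 2 * A) : g = 0 := by
  by_contra hg
  have hA : 0 < |A| + 1 := by positivity
  have h1 := h (-g / (|A| + 1))
  have h2 : -g / (|A| + 1) * g + (-g / (|A| + 1)) ^ 2 * A
      = g ^ 2 * (A - (|A| + 1)) / (|A| + 1) ^ 2 := by field_simp; ring
  rw [h2] at h1
  have h3 : g ^ 2 * (A - (|A| + 1)) < 0 :=
    mul_neg_of_pos_of_neg (by positivity) (by linarith [le_abs_self A])
  exact absurd h1 (not_le.2 (div_neg_of_neg_of_pos h3 (by positivity)))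

/-- The gradient of `pairingForm x` vanishes at `s`. -/
def PairingGradZero (x : Fin 9 → ℝ) (s : Fin 3 → ℝ) : Prop :=
  2 * x 8 * s 0 + (x 7 - x 0) * s 1 + (x 6 - x 1) * s 2 = 0 ∧
  2 * x 5 * s 1 + (x 7 - x 0) * s 0 + (x 4 - x 2) * s 2 = 0 ∧
  2 * x 3 * s 2 + (x 6 - x 1) * s 0 + (x 4 - x 2) * s 1 = 0

lemma pairingGradZero_of_nonneg {x : Fin 9 → ℝ} {s : Fin 3 → ℝ}
    (h : ∀ t, 0 ≤ pairingForm x t) (h0 : pairingForm x s = 0) : PairingGradZero x s := by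
  refine ⟨eq_zero_of_quadratic_nonneg (A := x 8) fun t => ?_,
    eq_zero_of_quadratic_nonneg (A := x 5) fun t => ?_,
    eq_zero_of_quadratic_nonneg (A := x 3) fun t => ?_⟩
  · have := h ![s 0 + t, s 1, s 2]
    simp only [pairingForm] at this h0
    simp at this
    linarith
  · have := h ![s 0, s 1 + t, s 2]
    simp only [pairingForm] at this h0
    simp at this
    linarith
  · have := h ![s 0, s 1, s 2 + t]
    simp only [pairingForm] at this h0
    simp at this
    linarith

lemma pairingForm_add_smul (a b : ℝ) (x y : Fin 9 → ℝ) (s : Fin 3 → ℝ) :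
    pairingForm (a • x + b • y) s = a * pairingForm x s + b * pairingForm y s := by
  simp only [pairingForm, Pi.add_apply, Pi.smul_apply, smul_eq_mul]
  ring

lemma pairingForm_eq_zero_of_mem_openSegment {x y z : Fin 9 → ℝ} {s : Fin 3 → ℝ}
    (hx : x ∈ pptSpectra) (hy : y ∈ pptSpectra) (hz : z ∈ openSegment ℝ x y)
    (σ : Equiv.Perm (Fin 9)) (hσ : z ∘ σ = z) (h0 : pairingForm z s = 0) :
    pairingForm (x ∘ σ) s = 0 := by
  obtain ⟨a, b, ha, hb, -, rfl⟩ := hz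
  rw [← hσ] at h0
  have h1 : pairingForm ((a • x + b • y) ∘ σ) s
      = a * pairingForm (x ∘ σ) s + b * pairingForm (y ∘ σ) s :=
    pairingForm_add_smul a b (x ∘ σ) (y ∘ σ) s
  rw [h1] at h0
  have hx' := (mem_pptSpectra_iff.1 hx).2 s σ
  have hy' := (mem_pptSpectra_iff.1 hy).2 s σ
  have h2 : a * pairingForm (x ∘ σ) s = 0 := by
    linarith [mul_nonneg ha.le hx', mul_nonneg hb.le hy']
  exact (mul_eq_zero.1 h2).resolve_left ha.ne'

/-- Exchanging the equal entries i and j fixes z, so both x and its exchanged copy pair to zero with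
the eigenvalues. The difference of the two pairings is (λ_i - λ_j)(x i - x j). -/
lemma apply_eq_of_mem_openSegment {x y z : Fin 9 → ℝ} {s : Fin 3 → ℝ}
    (hx : x ∈ pptSpectra) (hy : y ∈ pptSpectra) (hz : z ∈ openSegment ℝ x y)
    (h0 : pairingForm z s = 0) (i j : Fin 9) (hij : z i = z j)
    (hm : sortedEigenvalue s i ≠ sortedEigenvalue s j) : x i = x j := by
  have hσ : z ∘ Equiv.swap i j = z := by
    ext l
    by_cases h1 : l = i
    · subst h1; simp [hij]
    · by_cases h2 : l = j
      · subst h2; simp [hij]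
      · simp [Equiv.swap_apply_of_ne_of_ne h1 h2]
  have h1 := pairingForm_eq_zero_of_mem_openSegment hx hy hz 1 rfl h0
  have h2 := pairingForm_eq_zero_of_mem_openSegment hx hy hz _ hσ h0
  rw [← sum_sortedEigenvalue_mul] at h1 h2
  have hne : i ≠ j := fun h => hm (by rw [h])
  have h3 : ∑ l, sortedEigenvalue s l * ((x ∘ (1 : Equiv.Perm (Fin 9))) l
      - (x ∘ Equiv.swap i j) l) = 0 := by
    simp only [mul_sub, Finset.sum_sub_distrib, h1, h2, sub_zero]
  rw [Fintype.sum_eq_add i j hne] at h3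
  · simp only [Function.comp_apply, Equiv.Perm.coe_one, id, Equiv.swap_apply_left,
      Equiv.swap_apply_right] at h3
    have h4 : (sortedEigenvalue s i - sortedEigenvalue s j) * (x i - x j) = 0 := by linarith
    exact sub_eq_zero.1 ((mul_eq_zero.1 h4).resolve_left (sub_ne_zero.2 hm))
  · rintro l ⟨h1, h2⟩
    simp [Equiv.swap_apply_of_ne_of_ne h1 h2]

lemma pairingGradZero_of_mem_openSegment {x y z : Fin 9 → ℝ} {s : Fin 3 → ℝ}
    (hx : x ∈ pptSpectra) (hy : y ∈ pptSpectra) (hz : z ∈ openSegment ℝ x y)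
    (h0 : pairingForm z s = 0) : PairingGradZero x s :=
  pairingGradZero_of_nonneg (fun t => (mem_pptSpectra_iff.1 hx).2 t 1)
    (pairingForm_eq_zero_of_mem_openSegment hx hy hz 1 rfl h0)

/-! ### The spectra `(a, b, …, b, c, …, c)` -/

/-- The spectrum of `nu k a b c`. -/
def nuVec (k : ℕ) (a b c : ℝ) : Fin 9 → ℝ :=
  fun i => if (i : ℕ) = 0 then a else if (i : ℕ) ≤ k then b else c

lemma sum_nuVec {k : ℕ} (hk : k ≤ 8) (a b c : ℝ) :
    ∑ i, nuVec k a b c i = a + k * b + (8 - k) * c := by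
  interval_cases k <;> simp [nuVec, Fin.sum_univ_succ] <;> ring

lemma antitone_nuVec {k : ℕ} {a b c : ℝ} (hab : b ≤ a) (hbc : c ≤ b) :
    Antitone (nuVec k a b c) := by
  intro i j hij
  have hij' : (i : ℕ) ≤ j := hij
  simp only [nuVec]
  split_ifs <;> first | omega | linarith

lemma not_mem_extremePoints_nuVec {k : ℕ} {a b c v₁ v₂ v₃ : ℝ} (hv : v₁ ≠ 0)
    (h : ∀ᶠ t in 𝓝 (0 : ℝ), nuVec k (a + t * v₁) (b + t * v₂) (c + t * v₃) ∈ pptSpectra) :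
    nuVec k a b c ∉ Set.extremePoints ℝ pptSpectra := by
  intro hext
  have hneg : Filter.Tendsto (fun t : ℝ => -t) (𝓝 0) (𝓝 0) := by
    simpa using (continuous_neg (G := ℝ)).tendsto 0
  obtain ⟨t, ⟨h1, h2⟩, ht⟩ := (((h.and (hneg.eventually h)).filter_mono
    (nhdsWithin_le_nhds (s := Set.Ioi 0))).and self_mem_nhdsWithin).exists
  have h3 := (mem_extremePoints_iff_left.1 hext).2 _ h1 _ h2
    ⟨1 / 2, 1 / 2, by norm_num, by norm_num, by norm_num, ?_⟩
  · have h4 := congrFun h3 0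
    simp only [nuVec, Fin.val_zero, if_true] at h4
    have : t * v₁ = 0 := by linarith
    rcases mul_eq_zero.1 this with h | h
    · exact absurd h (ne_of_gt ht)
    · exact hv h
  · ext i
    simp only [nuVec, Pi.add_apply, Pi.smul_apply, smul_eq_mul]
    split_ifs <;> ring

lemma isExtremeNu_iff {k : ℕ} {a b c : ℝ} : IsExtremeNu k a b c ↔
    0 < c ∧ c < b ∧ b < a ∧ nuVec k a b c ∈ Set.extremePoints ℝ pptSpectra := by
  rw [← diag9_mem_extremePoints_iff]
  rfl

lemma nuVec_mem_extremePoints {k : ℕ} (hk : k ≤ 8) {a b c : ℝ} (hc : 0 < c)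
    (hmem : nuVec k a b c ∈ pptSpectra)
    (h : ∀ x ∈ pptSpectra, ∀ y ∈ pptSpectra, nuVec k a b c ∈ openSegment ℝ x y →
      ∃ a' b' c', x = nuVec k a' b' c' ∧ c * a' = c' * a ∧ c * b' = c' * b) :
    nuVec k a b c ∈ Set.extremePoints ℝ pptSpectra := by
  rw [mem_extremePoints_iff_left]
  refine ⟨hmem, fun x hx y hy hxy => ?_⟩
  obtain ⟨a', b', c', rfl, ha, hb⟩ := h x hx y hy hxy
  have h1 := hmem.1
  have h2 := hx.1
  rw [sum_nuVec hk] at h1 h2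
  have hcc : c' = c := by
    have h3 : c * (a' + k * b' + (8 - k) * c') = c' * (a + k * b + (8 - k) * c) := by
      linear_combination ha + k * hb
    rw [h1, h2] at h3
    linarith
  subst hcc
  rw [mul_left_cancel₀ hc.ne' ha, mul_left_cancel₀ hc.ne' hb]

theorem isExtremeNu_iff_of_boundary {k : ℕ} (hk : k ≤ 8) (hk0 : k ≠ 0) (G : ℝ → ℝ → ℝ → ℝ)
    (hG : Continuous fun p : ℝ × ℝ × ℝ => G p.1 p.2.1 p.2.2)
    (suff : ∀ a b c : ℝ, 0 < c → c < b → b < a → a + k * b + (8 - k) * c = 1 → 0 ≤ G a b c →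
      nuVec k a b c ∈ pptSpectra)
    (nec : ∀ a b c : ℝ, 0 < c → c < b → b < a → nuVec k a b c ∈ pptSpectra → 0 ≤ G a b c)
    (ext : ∀ a b c : ℝ, 0 < c → c < b → b < a → nuVec k a b c ∈ pptSpectra → G a b c = 0 →
      nuVec k a b c ∈ Set.extremePoints ℝ pptSpectra) (a b c : ℝ) :
    IsExtremeNu k a b c ↔
      0 < c ∧ c < b ∧ b < a ∧ a + k * b + (8 - k) * c = 1 ∧ G a b c = 0 := by
  rw [isExtremeNu_iff]
  refine and_congr_right fun hc => and_congr_right fun hcb => and_congr_right fun hba => ?_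
  constructor
  · intro h
    have hmem := h.1
    have hsum := hmem.1
    rw [sum_nuVec hk] at hsum
    refine ⟨hsum, ?_⟩
    by_contra hne
    have hpos : 0 < G a b c := lt_of_le_of_ne (nec a b c hc hcb hba hmem) (Ne.symm hne)
    -- The direction (k, -1, 0) keeps the trace, since the entry b occurs k times.
    refine not_mem_extremePoints_nuVec (v₁ := k) (v₂ := -1) (v₃ := 0) (by exact_mod_cast hk0) ?_ h
    have hcont : Continuous fun t : ℝ => G (a + t * k) (b + t * (-1)) (c + t * 0) :=
      hG.comp (by fun_prop : Continuous fun t : ℝ => (a + t * k, b + t * (-1), c + t * 0))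
    have e1 : ∀ᶠ t in 𝓝 (0 : ℝ), 0 < G (a + t * k) (b + t * (-1)) (c + t * 0) :=
      hcont.continuousAt.eventually (lt_mem_nhds (by simpa using hpos))
    have e2 : ∀ᶠ t in 𝓝 (0 : ℝ), c + t * 0 < b + t * (-1) :=
      ContinuousAt.eventually_lt (by fun_prop) (by fun_prop) (by simpa using hcb)
    have e3 : ∀ᶠ t in 𝓝 (0 : ℝ), b + t * (-1) < a + t * k :=
      ContinuousAt.eventually_lt (by fun_prop) (by fun_prop) (by simpa using hba)
    filter_upwards [e1, e2, e3] with t h1 h2 h3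
    exact suff _ _ _ (by simpa using hc) h2 h3 (by linarith) h1.le
  · rintro ⟨hsum, h0⟩
    exact ext a b c hc hcb hba (suff a b c hc hcb hba hsum h0.ge) h0

/-! ### Sufficient conditions, by completing squares -/

section rows

variable {a b c : ℝ}

lemma nuVec_one_mem (hc : 0 < c) (hcb : c < b) (hba : b < a)
    (hsum : a + (1 : ℕ) * b + (8 - (1 : ℕ)) * c = 1)
    (h : 0 ≤ 4 * c ^ 2 - (a - c) ^ 2 - (b - c) ^ 2) : nuVec 1 a b c ∈ pptSpectra := by
  have key : ∀ u v w : ℝ, 0 ≤ 4 * c * (c * u ^ 2 + c * v ^ 2 + c * w ^ 2 - (a - c) * (u * v)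
      - (b - c) * (u * w)) := by
    intro u v w
    -- With p = a - c and q = b - c, Lagrange's identity (p² + q²)(v² + w²) = (pv + qw)² + (pw -
    -- qv)² accounts for the two squares below.
    have := mul_nonneg h (add_nonneg (sq_nonneg v) (sq_nonneg w))
    linarith [sq_nonneg (2 * c * u - (a - c) * v - (b - c) * w),
      sq_nonneg ((a - c) * w - (b - c) * v)]
  refine mem_pptSpectra_of_antitone (antitone_nuVec hba.le hcb.le)
    (by rw [sum_nuVec (by norm_num), hsum]) ?_ ?_ <;>
  · intro u v w _ _ _
    refine (nonneg_of_mul_nonneg_right (key u v w) (by positivity)).trans_eq ?_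
    simp [pairingForm, nuVec, Equiv.swap_apply_def]
    ring

lemma nuVec_two_mem (hc : 0 < c) (hcb : c < b) (hba : b < a)
    (hsum : a + (2 : ℕ) * b + (8 - (2 : ℕ)) * c = 1)
    (h : 0 ≤ c * (3 * c - a) - (b - c) ^ 2) : nuVec 2 a b c ∈ pptSpectra := by
  have key : ∀ u v w : ℝ, 0 ≤ 4 * c * (c * u ^ 2 + c * v ^ 2 + c * w ^ 2 - (a - c) * (u * v)
      - (b - c) * (u * w) - (b - c) * (v * w)) := by
    intro u v w
    have h1 := mul_nonneg h (sq_nonneg (u + v))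
    have h2 : 0 ≤ (2 * c ^ 2 + (a - c) * c) * (u - v) ^ 2 := by
      have : 0 < a - c := by linarith
      positivity
    linarith [sq_nonneg (2 * c * w - (b - c) * (u + v))]
  refine mem_pptSpectra_of_antitone (antitone_nuVec hba.le hcb.le)
    (by rw [sum_nuVec (by norm_num), hsum]) ?_ ?_ <;>
  · intro u v w _ _ _
    refine (nonneg_of_mul_nonneg_right (key u v w) (by positivity)).trans_eq ?_
    simp [pairingForm, nuVec, Equiv.swap_apply_def]
    ring

lemma nuVec_three_mem (hc : 0 < c) (hcb : c < b) (hba : b < a)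
    (hsum : a + (3 : ℕ) * b + (8 - (3 : ℕ)) * c = 1)
    (h : 0 ≤ b * (3 * c - a) - (b - c) ^ 2) : nuVec 3 a b c ∈ pptSpectra := by
  have hb := hc.trans hcb
  have key : ∀ u v w : ℝ, 0 ≤ 4 * b * (c * u ^ 2 + c * v ^ 2 + b * w ^ 2 - (a - c) * (u * v)
      - (b - c) * (u * w) - (b - c) * (v * w)) := by
    intro u v w
    have h1 := mul_nonneg h (sq_nonneg (u + v))
    have h2 : 0 ≤ (b * (2 * c + (a - c))) * (u - v) ^ 2 := by
      have : 0 < a - c := by linarith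
      positivity
    linarith [sq_nonneg (2 * b * w - (b - c) * (u + v))]
  refine mem_pptSpectra_of_antitone (antitone_nuVec hba.le hcb.le)
    (by rw [sum_nuVec (by norm_num), hsum]) ?_ ?_ <;>
  · intro u v w _ _ _
    refine (nonneg_of_mul_nonneg_right (key u v w) (by positivity)).trans_eq ?_
    simp [pairingForm, nuVec, Equiv.swap_apply_def]
    ring

lemma nuVec_four_mem (hc : 0 < c) (hcb : c < b) (hba : b < a)
    (hsum : a + (4 : ℕ) * b + (8 - (4 : ℕ)) * c = 1)
    (h : 0 ≤ 4 * c ^ 2 * b - b * (a - c) ^ 2 - c * (b - c) ^ 2) : nuVec 4 a b c ∈ pptSpectra := by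
  have hb := hc.trans hcb
  have key : ∀ u v w : ℝ, 0 ≤ 4 * b * c * (c * u ^ 2 + c * v ^ 2 + b * w ^ 2 - (a - c) * (u * v)
      - (b - c) * (u * w)) := by
    intro u v w
    have h1 := mul_nonneg h (sq_nonneg u)
    linarith [mul_nonneg hb.le (sq_nonneg (2 * c * v - (a - c) * u)),
      mul_nonneg hc.le (sq_nonneg (2 * b * w - (b - c) * u))]
  refine mem_pptSpectra_of_antitone (antitone_nuVec hba.le hcb.le)
    (by rw [sum_nuVec (by norm_num), hsum]) ?_ ?_ <;>
  · intro u v w _ _ _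
    refine (nonneg_of_mul_nonneg_right (key u v w) (by positivity)).trans_eq ?_
    simp [pairingForm, nuVec, Equiv.swap_apply_def]
    ring

/-- Here entries 5 and 6 of the spectrum are b and c, so the two orders give different forms. The
exchanged order requires a ≤ 3c, and this bound already makes the other form nonnegative. -/
lemma nuVec_five_mem (hc : 0 < c) (hcb : c < b) (hba : b < a)
    (hsum : a + (5 : ℕ) * b + (8 - (5 : ℕ)) * c = 1)
    (h : a ≤ 3 * c) : nuVec 5 a b c ∈ pptSpectra := by
  have hb := hc.trans hcb
  refine mem_pptSpectra_of_antitone (antitone_nuVec hba.le hcb.le)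
    (by rw [sum_nuVec (by norm_num), hsum]) ?_ ?_
  · intro u v w _ _ _
    have key : 0 ≤ 4 * b * (c * u ^ 2 + b * v ^ 2 + b * w ^ 2 - (a - c) * (u * v)
        - (b - c) * (u * w)) := by
      have h1 : 0 ≤ 4 * b * c - (a - c) ^ 2 - (b - c) ^ 2 := by
        nlinarith [mul_nonneg (sub_nonneg.2 h) (by linarith : (0 : ℝ) ≤ a + c),
          mul_nonneg (by linarith : (0 : ℝ) ≤ b - c) (by linarith : (0 : ℝ) ≤ 5 * c - b)]
      have h2 := mul_nonneg h1 (sq_nonneg u)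
      linarith [sq_nonneg (2 * b * v - (a - c) * u), sq_nonneg (2 * b * w - (b - c) * u)]
    refine (nonneg_of_mul_nonneg_right key (by positivity)).trans_eq ?_
    simp [pairingForm, nuVec]
    ring
  · intro u v w hw hwv hvu
    have hv := hw.trans hwv
    have key : 0 ≤ c * (u - v) ^ 2 + (3 * c - a) * (u * v) + b * w ^ 2 := by
      have : 0 ≤ 3 * c - a := by linarith
      have : 0 ≤ u := hv.trans hvu
      positivity
    refine key.trans_eq ?_
    simp [pairingForm, nuVec, Equiv.swap_apply_def]
    ring

lemma nuVec_six_mem (hc : 0 < c) (hcb : c < b) (hba : b < a)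
    (hsum : a + (6 : ℕ) * b + (8 - (6 : ℕ)) * c = 1)
    (h : 0 ≤ 4 * b * c - (a - c) ^ 2) : nuVec 6 a b c ∈ pptSpectra := by
  have hb := hc.trans hcb
  have key : ∀ u v w : ℝ, 0 ≤ 4 * b * (c * u ^ 2 + b * v ^ 2 + b * w ^ 2
      - (a - c) * (u * v)) := by
    intro u v w
    have h1 := mul_nonneg h (sq_nonneg u)
    linarith [sq_nonneg (2 * b * v - (a - c) * u), sq_nonneg (2 * b * w)]
  refine mem_pptSpectra_of_antitone (antitone_nuVec hba.le hcb.le)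
    (by rw [sum_nuVec (by norm_num), hsum]) ?_ ?_ <;>
  · intro u v w _ _ _
    refine (nonneg_of_mul_nonneg_right (key u v w) (by positivity)).trans_eq ?_
    simp [pairingForm, nuVec, Equiv.swap_apply_def]
    ring

lemma nuVec_seven_mem (hc : 0 < c) (hcb : c < b) (hba : b < a)
    (hsum : a + (7 : ℕ) * b + (8 - (7 : ℕ)) * c = 1)
    (h : 0 ≤ 4 * b * c - (a - b) ^ 2) : nuVec 7 a b c ∈ pptSpectra := by
  have hb := hc.trans hcb
  have key : ∀ u v w : ℝ, 0 ≤ 4 * b * (c * u ^ 2 + b * v ^ 2 + b * w ^ 2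
      - (a - b) * (u * v)) := by
    intro u v w
    have h1 := mul_nonneg h (sq_nonneg u)
    linarith [sq_nonneg (2 * b * v - (a - b) * u), sq_nonneg (2 * b * w)]
  refine mem_pptSpectra_of_antitone (antitone_nuVec hba.le hcb.le)
    (by rw [sum_nuVec (by norm_num), hsum]) ?_ ?_ <;>
  · intro u v w _ _ _
    refine (nonneg_of_mul_nonneg_right (key u v w) (by positivity)).trans_eq ?_
    simp [pairingForm, nuVec, Equiv.swap_apply_def]
    ring

/-! ### Necessary conditions, from test vectors that become kernel vectors on the boundary -/

lemma nuVec_one_eigenvalue_bound (hc : 0 < c) (h : nuVec 1 a b c ∈ pptSpectra) :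
    0 ≤ 4 * c ^ 2 - (a - c) ^ 2 - (b - c) ^ 2 := by
  have h1 := (mem_pptSpectra_iff.1 h).2 ![2 * c, a - c, b - c] 1
  refine nonneg_of_mul_nonneg_right (h1.trans_eq ?_ : 0 ≤ c * _) hc
  simp [pairingForm, nuVec]
  ring

lemma nuVec_two_eigenvalue_bound (hc : 0 < c) (h : nuVec 2 a b c ∈ pptSpectra) :
    0 ≤ c * (3 * c - a) - (b - c) ^ 2 := by
  have h1 := (mem_pptSpectra_iff.1 h).2 ![c, c, b - c] 1
  refine nonneg_of_mul_nonneg_right (h1.trans_eq ?_ : 0 ≤ c * _) hc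
  simp [pairingForm, nuVec]
  ring

lemma nuVec_three_eigenvalue_bound (hb : 0 < b) (h : nuVec 3 a b c ∈ pptSpectra) :
    0 ≤ b * (3 * c - a) - (b - c) ^ 2 := by
  have h1 := (mem_pptSpectra_iff.1 h).2 ![b, b, b - c] 1
  refine nonneg_of_mul_nonneg_right (h1.trans_eq ?_ : 0 ≤ b * _) hb
  simp [pairingForm, nuVec]
  ring

lemma nuVec_four_eigenvalue_bound (hb : 0 < b) (hc : 0 < c) (h : nuVec 4 a b c ∈ pptSpectra) :
    0 ≤ 4 * c ^ 2 * b - b * (a - c) ^ 2 - c * (b - c) ^ 2 := by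
  have h1 := (mem_pptSpectra_iff.1 h).2 ![2 * b * c, b * (a - c), c * (b - c)] 1
  refine nonneg_of_mul_nonneg_right (h1.trans_eq ?_ : 0 ≤ (b * c) * _) (mul_pos hb hc)
  simp [pairingForm, nuVec]
  ring

lemma nuVec_five_eigenvalue_bound (h : nuVec 5 a b c ∈ pptSpectra) : a ≤ 3 * c := by
  have h1 := (mem_pptSpectra_iff.1 h).2 ![1, 1, 0] (Equiv.swap 5 6)
  simp [pairingForm, nuVec, Equiv.swap_apply_def] at h1
  linarith

lemma nuVec_six_eigenvalue_bound (hb : 0 < b) (h : nuVec 6 a b c ∈ pptSpectra) :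
    0 ≤ 4 * b * c - (a - c) ^ 2 := by
  have h1 := (mem_pptSpectra_iff.1 h).2 ![2 * b, a - c, 0] 1
  refine nonneg_of_mul_nonneg_right (h1.trans_eq ?_ : 0 ≤ b * _) hb
  simp [pairingForm, nuVec]
  ring

lemma nuVec_seven_eigenvalue_bound (hb : 0 < b) (h : nuVec 7 a b c ∈ pptSpectra) :
    0 ≤ 4 * b * c - (a - b) ^ 2 := by
  have h1 := (mem_pptSpectra_iff.1 h).2 ![2 * b, a - b, 0] 1
  refine nonneg_of_mul_nonneg_right (h1.trans_eq ?_ : 0 ≤ b * _) hb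
  simp [pairingForm, nuVec]
  ring

end rows

/-! ### Extremality on the boundary -/

lemma sortedEigenvalue_vec (u v w : ℝ) :
    sortedEigenvalue ![u, v, w] =
      ![-(u * v), -(u * w), -(v * w), w * w, v * w, v * v, u * w, u * v, u * u] := rfl

section rows

variable {a b c : ℝ}

lemma nuVec_one_mem_extremePoints (hc : 0 < c) (hcb : c < b) (hba : b < a)
    (hmem : nuVec 1 a b c ∈ pptSpectra) (h0 : 4 * c ^ 2 - (a - c) ^ 2 - (b - c) ^ 2 = 0) :
    nuVec 1 a b c ∈ Set.extremePoints ℝ pptSpectra := by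
  refine nuVec_mem_extremePoints (by norm_num) hc hmem fun x hx y hy hxy => ?_
  have hz : pairingForm (nuVec 1 a b c) ![2 * c, a - c, b - c] = 0 := by
    simp [pairingForm, nuVec]
    linear_combination c * h0
  have E := apply_eq_of_mem_openSegment hx hy hxy hz
  have G := pairingGradZero_of_mem_openSegment hx hy hxy hz
  have hp : 0 < a - c := by linarith
  have hq : 0 < b - c := by linarith
  simp only [sortedEigenvalue_vec] at E
  have hneg : -((a - c) * (b - c)) < 0 := neg_neg_of_pos (by positivity)
  -- Among the positions of c only position 2 carries a negative eigenvalue, so each other entry can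
  -- be compared with it.
  have e3 : x 2 = x 3 := E 2 3 rfl (hneg.trans (by simp; positivity)).ne
  have e4 : x 2 = x 4 := E 2 4 rfl (hneg.trans (by simp; positivity)).ne
  have e5 : x 2 = x 5 := E 2 5 rfl (hneg.trans (by simp; positivity)).ne
  have e6 : x 2 = x 6 := E 2 6 rfl (hneg.trans (by simp; positivity)).ne
  have e7 : x 2 = x 7 := E 2 7 rfl (hneg.trans (by simp; positivity)).ne
  have e8 : x 2 = x 8 := E 2 8 rfl (hneg.trans (by simp; positivity)).ne
  refine ⟨x 0, x 1, x 2, ?_, ?_⟩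
  · ext i; fin_cases i <;> simp [nuVec, ← e3, ← e4, ← e5, ← e6, ← e7, ← e8]
  · simp only [PairingGradZero, ← e3, ← e4, ← e5, ← e6, ← e7, ← e8] at G
    simp at G
    obtain ⟨g0, g1, g2⟩ := G
    exact ⟨by linarith, by linarith⟩

lemma nuVec_two_mem_extremePoints (hc : 0 < c) (hcb : c < b) (hba : b < a)
    (hmem : nuVec 2 a b c ∈ pptSpectra) (h0 : c * (3 * c - a) - (b - c) ^ 2 = 0) :
    nuVec 2 a b c ∈ Set.extremePoints ℝ pptSpectra := by
  refine nuVec_mem_extremePoints (by norm_num) hc hmem fun x hx y hy hxy => ?_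
  have hz : pairingForm (nuVec 2 a b c) ![c, c, b - c] = 0 := by
    simp [pairingForm, nuVec]
    linear_combination c * h0
  have E := apply_eq_of_mem_openSegment hx hy hxy hz
  have G := pairingGradZero_of_mem_openSegment hx hy hxy hz
  have hq : 0 < b - c := by linarith
  have hqc : b - c < c := by nlinarith
  have h1 : (b - c) * (b - c) < c * (b - c) := mul_lt_mul_of_pos_right hqc hq
  have h2 : (b - c) * (b - c) < c * c := mul_self_lt_mul_self hq.le hqc
  simp only [sortedEigenvalue_vec] at E
  have e4 : x 3 = x 4 := E 3 4 rfl h1.ne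
  have e5 : x 3 = x 5 := E 3 5 rfl h2.ne
  have e6 : x 3 = x 6 := E 3 6 rfl h1.ne
  have e7 : x 3 = x 7 := E 3 7 rfl h2.ne
  have e8 : x 3 = x 8 := E 3 8 rfl h2.ne
  simp only [PairingGradZero, ← e4, ← e5, ← e6, ← e7, ← e8] at G
  simp at G
  obtain ⟨g0, g1, g2⟩ := G
  -- Positions 1 and 2 carry equal eigenvalues, so the exchange argument says nothing here. The
  -- difference of the first two gradient equations is used instead.
  have e2 : x 1 = x 2 := mul_right_cancel₀ hq.ne' (by linarith)
  rw [← e2] at g1 g2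
  have hb : c * x 1 = x 3 * b := by linarith
  refine ⟨x 0, x 1, x 3, ?_, ?_, hb⟩
  · ext i; fin_cases i <;> simp [nuVec, ← e2, ← e4, ← e5, ← e6, ← e7, ← e8]
  · refine mul_left_cancel₀ hc.ne' ?_
    linear_combination (-c) * g0 - (b - c) * hb + x 3 * h0

lemma nuVec_three_mem_extremePoints (hc : 0 < c) (hcb : c < b) (_ : b < a)
    (hmem : nuVec 3 a b c ∈ pptSpectra) (h0 : b * (3 * c - a) - (b - c) ^ 2 = 0) :
    nuVec 3 a b c ∈ Set.extremePoints ℝ pptSpectra := by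
  refine nuVec_mem_extremePoints (by norm_num) hc hmem fun x hx y hy hxy => ?_
  have hz : pairingForm (nuVec 3 a b c) ![b, b, b - c] = 0 := by
    simp [pairingForm, nuVec]
    linear_combination b * h0
  have E := apply_eq_of_mem_openSegment hx hy hxy hz
  have G := pairingGradZero_of_mem_openSegment hx hy hxy hz
  have hb : 0 < b := hc.trans hcb
  have hq : 0 < b - c := by linarith
  have h1 : b * (b - c) < b * b := mul_lt_mul_of_pos_left (by linarith) hb
  have hneg : -(b * (b - c)) < (b - c) * (b - c) :=
    (neg_neg_of_pos (by positivity)).trans (by positivity)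
  simp only [sortedEigenvalue_vec] at E
  have e2 : x 1 = x 3 := E 1 3 rfl hneg.ne
  have e3 : x 2 = x 3 := E 2 3 rfl hneg.ne
  have e5 : x 4 = x 5 := E 4 5 rfl h1.ne
  have e6 : x 6 = x 5 := E 6 5 rfl h1.ne
  have e7 : x 4 = x 7 := E 4 7 rfl h1.ne
  have e8 : x 4 = x 8 := E 4 8 rfl h1.ne
  rw [← e5] at e6
  rw [← e2] at e3
  simp only [PairingGradZero, e3, ← e2, ← e5, e6, ← e7, ← e8] at G
  simp at G
  obtain ⟨g0, g2⟩ := G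
  have hb' : c * x 1 = x 4 * b := by
    refine mul_left_cancel₀ (two_ne_zero (α := ℝ)) ?_
    linarith
  refine ⟨x 0, x 1, x 4, ?_, ?_, hb'⟩
  · ext i; fin_cases i <;> simp [nuVec, e3, ← e2, ← e5, e6, ← e7, ← e8]
  · refine mul_left_cancel₀ (mul_pos hb hb).ne' ?_
    linear_combination (-(b * c)) * g0 - (b - c) * b * hb' + x 4 * b * h0

lemma nuVec_four_mem_extremePoints (hc : 0 < c) (hcb : c < b) (hba : b < a)
    (hmem : nuVec 4 a b c ∈ pptSpectra)
    (h0 : 4 * c ^ 2 * b - b * (a - c) ^ 2 - c * (b - c) ^ 2 = 0) :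
    nuVec 4 a b c ∈ Set.extremePoints ℝ pptSpectra := by
  refine nuVec_mem_extremePoints (by norm_num) hc hmem fun x hx y hy hxy => ?_
  have hz : pairingForm (nuVec 4 a b c) ![2 * b * c, b * (a - c), c * (b - c)] = 0 := by
    simp [pairingForm, nuVec]
    linear_combination b * c * h0
  have E := apply_eq_of_mem_openSegment hx hy hxy hz
  have G := pairingGradZero_of_mem_openSegment hx hy hxy hz
  have hb : 0 < b := hc.trans hcb
  have hp : 0 < a - c := by linarith
  have hq : 0 < b - c := by linarith
  -- This makes the kernel vector strictly decreasing, which separates the eigenvalue at position 7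
  -- from those at 5, 6 and 8.
  have hp2 : a - c < 2 * c := by
    refine lt_of_pow_lt_pow_left₀ 2 (by positivity) ?_
    have : 0 < c * (b - c) ^ 2 := by positivity
    refine lt_of_mul_lt_mul_left ?_ hb.le
    linarith
  have h01 : b * (a - c) < 2 * b * c := by linarith [mul_lt_mul_of_pos_left hp2 hb]
  have h12 : c * (b - c) < b * (a - c) := mul_lt_mul hcb (by linarith) hq hb.le
  simp only [sortedEigenvalue_vec] at E
  have e1 : x 3 = x 1 :=
    E 3 1 rfl (lt_trans (b := 0) (by simp; positivity) (mul_pos (mul_pos hc hq) (mul_pos hc hq))).ne'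
  have e2 : x 3 = x 2 :=
    E 3 2 rfl (lt_trans (b := 0) (by simp; positivity) (mul_pos (mul_pos hc hq) (mul_pos hc hq))).ne'
  have e4 : x 1 = x 4 :=
    E 1 4 rfl (lt_trans (b := 0) (by simp; positivity) (by simp; positivity)).ne
  have e5 : x 7 = x 5 := E 7 5 rfl (mul_lt_mul_of_pos_right h01 (by positivity)).ne'
  have e6 : x 7 = x 6 :=
    E 7 6 rfl (mul_lt_mul_of_pos_left h12 (by positivity : 0 < 2 * b * c)).ne'
  have e8 : x 7 = x 8 :=
    E 7 8 rfl (mul_lt_mul_of_pos_left h01 (by positivity : 0 < 2 * b * c)).ne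
  rw [← e1] at e4
  simp only [PairingGradZero, ← e1, ← e2, ← e4, ← e5, ← e6, ← e8] at G
  simp at G
  obtain ⟨g0, g1, g2⟩ := G
  refine ⟨x 0, x 3, x 7, ?_, ?_, ?_⟩
  · ext i; fin_cases i <;> simp [nuVec, ← e1, ← e2, ← e4, ← e5, ← e6, ← e8]
  · refine mul_left_cancel₀ (mul_pos two_pos hb).ne' ?_
    linear_combination -g1
  · refine mul_left_cancel₀ (mul_pos two_pos hc).ne' ?_
    linear_combination -g2

lemma nuVec_six_mem_extremePoints (hc : 0 < c) (hcb : c < b) (hba : b < a)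
    (hmem : nuVec 6 a b c ∈ pptSpectra) (h0 : 4 * b * c - (a - c) ^ 2 = 0) :
    nuVec 6 a b c ∈ Set.extremePoints ℝ pptSpectra := by
  refine nuVec_mem_extremePoints (by norm_num) hc hmem fun x hx y hy hxy => ?_
  have hz : pairingForm (nuVec 6 a b c) ![2 * b, a - c, 0] = 0 := by
    simp [pairingForm, nuVec]
    linear_combination b * h0
  have E := apply_eq_of_mem_openSegment hx hy hxy hz
  have G := pairingGradZero_of_mem_openSegment hx hy hxy hz
  have hb : 0 < b := hc.trans hcb
  have hp : 0 < a - c := by linarith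
  have h01 : a - c < 2 * b := by
    refine lt_of_pow_lt_pow_left₀ 2 (by positivity) ?_
    linarith [mul_lt_mul_of_pos_left hcb (by positivity : 0 < 4 * b)]
  simp only [sortedEigenvalue_vec] at E
  have e1 : x 5 = x 1 := E 5 1 rfl (by simp; positivity)
  have e2 : x 5 = x 2 := E 5 2 rfl (by simp; positivity)
  have e3 : x 5 = x 3 := E 5 3 rfl (by simp; positivity)
  have e4 : x 5 = x 4 := E 5 4 rfl (by simp; positivity)
  have e6 : x 5 = x 6 := E 5 6 rfl (by simp; positivity)
  have e8 : x 7 = x 8 := E 7 8 rfl (mul_lt_mul_of_pos_left h01 (by positivity : 0 < 2 * b)).ne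
  simp only [PairingGradZero, ← e1, ← e2, ← e3, ← e4, ← e6, ← e8] at G
  simp at G
  obtain ⟨g0, g1⟩ := G
  have hbc : c * x 5 = x 7 * b := by
    refine mul_left_cancel₀ (by positivity : 4 * b * 2 ≠ 0) ?_
    linear_combination (-2 * b) * g0 + (a - c) * g1 + 2 * x 5 * h0
  refine ⟨x 0, x 5, x 7, ?_, ?_, hbc⟩
  · ext i; fin_cases i <;> simp [nuVec, ← e1, ← e2, ← e3, ← e4, ← e6, ← e8]
  · refine mul_left_cancel₀ (mul_pos two_pos hb).ne' ?_
    linear_combination (-c) * g1 + 2 * (a - c) * hbc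

lemma nuVec_seven_mem_extremePoints (hc : 0 < c) (hcb : c < b) (hba : b < a)
    (hmem : nuVec 7 a b c ∈ pptSpectra) (h0 : 4 * b * c - (a - b) ^ 2 = 0) :
    nuVec 7 a b c ∈ Set.extremePoints ℝ pptSpectra := by
  refine nuVec_mem_extremePoints (by norm_num) hc hmem fun x hx y hy hxy => ?_
  have hz : pairingForm (nuVec 7 a b c) ![2 * b, a - b, 0] = 0 := by
    simp [pairingForm, nuVec]
    linear_combination b * h0
  have E := apply_eq_of_mem_openSegment hx hy hxy hz
  have G := pairingGradZero_of_mem_openSegment hx hy hxy hz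
  have hb : 0 < b := hc.trans hcb
  have hp : 0 < a - b := by linarith
  have h01 : a - b < 2 * b := by
    refine lt_of_pow_lt_pow_left₀ 2 (by positivity) ?_
    linarith [mul_lt_mul_of_pos_left hcb (by positivity : 0 < 4 * b)]
  simp only [sortedEigenvalue_vec] at E
  have e1 : x 5 = x 1 := E 5 1 rfl (by simp; positivity)
  have e2 : x 5 = x 2 := E 5 2 rfl (by simp; positivity)
  have e3 : x 5 = x 3 := E 5 3 rfl (by simp; positivity)
  have e4 : x 5 = x 4 := E 5 4 rfl (by simp; positivity)
  have e6 : x 5 = x 6 := E 5 6 rfl (by simp; positivity)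
  have e7 : x 5 = x 7 := E 5 7 rfl (mul_lt_mul_of_pos_right h01 hp).ne
  simp only [PairingGradZero, ← e1, ← e2, ← e3, ← e4, ← e6, ← e7] at G
  simp at G
  obtain ⟨g0, g1⟩ := G
  have hbc : c * x 5 = x 8 * b := by
    refine mul_left_cancel₀ (by positivity : 4 * b * 2 ≠ 0) ?_
    linear_combination (-2 * b) * g0 + (a - b) * g1 + 2 * x 5 * h0
  refine ⟨x 0, x 5, x 8, ?_, ?_, hbc⟩
  · ext i; fin_cases i <;> simp [nuVec, ← e1, ← e2, ← e3, ← e4, ← e6, ← e7]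
  · refine mul_left_cancel₀ (mul_pos two_pos hb).ne' ?_
    linear_combination (-c) * g1 + 2 * a * hbc

/-! ### Extreme points as solutions of the trace and boundary equations -/

lemma isExtremeNu_one_iff : IsExtremeNu 1 a b c ↔ 0 < c ∧ c < b ∧ b < a ∧
    a + (1 : ℕ) * b + (8 - (1 : ℕ)) * c = 1 ∧ 4 * c ^ 2 - (a - c) ^ 2 - (b - c) ^ 2 = 0 :=
  isExtremeNu_iff_of_boundary (by norm_num) (by norm_num)
    (fun a b c => 4 * c ^ 2 - (a - c) ^ 2 - (b - c) ^ 2) (by fun_prop)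
    (fun _ _ _ => nuVec_one_mem) (fun _ _ _ hc _ _ => nuVec_one_eigenvalue_bound hc)
    (fun _ _ _ => nuVec_one_mem_extremePoints) a b c

lemma isExtremeNu_two_iff : IsExtremeNu 2 a b c ↔ 0 < c ∧ c < b ∧ b < a ∧
    a + (2 : ℕ) * b + (8 - (2 : ℕ)) * c = 1 ∧ c * (3 * c - a) - (b - c) ^ 2 = 0 :=
  isExtremeNu_iff_of_boundary (by norm_num) (by norm_num)
    (fun a b c => c * (3 * c - a) - (b - c) ^ 2) (by fun_prop)
    (fun _ _ _ => nuVec_two_mem) (fun _ _ _ hc _ _ => nuVec_two_eigenvalue_bound hc)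
    (fun _ _ _ => nuVec_two_mem_extremePoints) a b c

lemma isExtremeNu_three_iff : IsExtremeNu 3 a b c ↔ 0 < c ∧ c < b ∧ b < a ∧
    a + (3 : ℕ) * b + (8 - (3 : ℕ)) * c = 1 ∧ b * (3 * c - a) - (b - c) ^ 2 = 0 :=
  isExtremeNu_iff_of_boundary (by norm_num) (by norm_num)
    (fun a b c => b * (3 * c - a) - (b - c) ^ 2) (by fun_prop)
    (fun _ _ _ => nuVec_three_mem)
    (fun _ _ _ hc hcb _ => nuVec_three_eigenvalue_bound (hc.trans hcb))
    (fun _ _ _ => nuVec_three_mem_extremePoints) a b c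

lemma isExtremeNu_four_iff : IsExtremeNu 4 a b c ↔ 0 < c ∧ c < b ∧ b < a ∧
    a + (4 : ℕ) * b + (8 - (4 : ℕ)) * c = 1 ∧
    4 * c ^ 2 * b - b * (a - c) ^ 2 - c * (b - c) ^ 2 = 0 :=
  isExtremeNu_iff_of_boundary (by norm_num) (by norm_num)
    (fun a b c => 4 * c ^ 2 * b - b * (a - c) ^ 2 - c * (b - c) ^ 2) (by fun_prop)
    (fun _ _ _ => nuVec_four_mem)
    (fun _ _ _ hc hcb _ => nuVec_four_eigenvalue_bound (hc.trans hcb) hc)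
    (fun _ _ _ => nuVec_four_mem_extremePoints) a b c

lemma not_isExtremeNu_five : ¬ IsExtremeNu 5 a b c := by
  rw [isExtremeNu_iff]
  rintro ⟨hc, hcb, hba, h⟩
  have hmem := h.1
  have hsum := hmem.1
  rw [sum_nuVec (by norm_num)] at hsum
  have h3 := nuVec_five_eigenvalue_bound hmem
  -- The direction (15, -6, 5) keeps the trace, as 15 - 5·6 + 3·5 = 0, and keeps a - 3c.
  refine not_mem_extremePoints_nuVec (v₁ := 15) (v₂ := -6) (v₃ := 5) (by norm_num) ?_ h
  have e1 : ∀ᶠ t in 𝓝 (0 : ℝ), 0 < c + t * 5 :=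
    ContinuousAt.eventually_lt (by fun_prop) (by fun_prop) (by simpa using hc)
  have e2 : ∀ᶠ t in 𝓝 (0 : ℝ), c + t * 5 < b + t * (-6) :=
    ContinuousAt.eventually_lt (by fun_prop) (by fun_prop) (by simpa using hcb)
  have e3 : ∀ᶠ t in 𝓝 (0 : ℝ), b + t * (-6) < a + t * 15 :=
    ContinuousAt.eventually_lt (by fun_prop) (by fun_prop) (by simpa using hba)
  filter_upwards [e1, e2, e3] with t h1 h2 h3
  refine nuVec_five_mem h1 h2 h3 ?_ (by linarith)
  push_cast at hsum ⊢
  linarith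

lemma isExtremeNu_six_iff : IsExtremeNu 6 a b c ↔ 0 < c ∧ c < b ∧ b < a ∧
    a + (6 : ℕ) * b + (8 - (6 : ℕ)) * c = 1 ∧ 4 * b * c - (a - c) ^ 2 = 0 :=
  isExtremeNu_iff_of_boundary (by norm_num) (by norm_num)
    (fun a b c => 4 * b * c - (a - c) ^ 2) (by fun_prop)
    (fun _ _ _ => nuVec_six_mem)
    (fun _ _ _ hc hcb _ => nuVec_six_eigenvalue_bound (hc.trans hcb))
    (fun _ _ _ => nuVec_six_mem_extremePoints) a b c

lemma isExtremeNu_seven_iff : IsExtremeNu 7 a b c ↔ 0 < c ∧ c < b ∧ b < a ∧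
    a + (7 : ℕ) * b + (8 - (7 : ℕ)) * c = 1 ∧ 4 * b * c - (a - b) ^ 2 = 0 :=
  isExtremeNu_iff_of_boundary (by norm_num) (by norm_num)
    (fun a b c => 4 * b * c - (a - b) ^ 2) (by fun_prop)
    (fun _ _ _ => nuVec_seven_mem)
    (fun _ _ _ hc hcb _ => nuVec_seven_eigenvalue_bound (hc.trans hcb))
    (fun _ _ _ => nuVec_seven_mem_extremePoints) a b c

end rows

/-! ### Rows of the classification with explicit radicals -/

lemma continuous_nu (k : ℕ) : Continuous fun p : ℝ × ℝ × ℝ => nu k p.1 p.2.1 p.2.2 := by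
  unfold nu diag9
  refine Continuous.matrix_diagonal (continuous_pi fun p => Complex.continuous_ofReal.comp ?_)
  dsimp only
  split_ifs <;> fun_prop

lemma tendsto_nu {ι : Type*} {l : Filter ι} (k : ℕ) {A B C : ι → ℝ} {a b c : ℝ}
    (hA : Filter.Tendsto A l (𝓝 a)) (hB : Filter.Tendsto B l (𝓝 b))
    (hC : Filter.Tendsto C l (𝓝 c)) :
    Filter.Tendsto (fun t => nu k (A t) (B t) (C t)) l (𝓝 (nu k a b c)) := by
  have h := ((continuous_nu k).tendsto (a, b, c)).comp (hA.prodMk_nhds (hB.prodMk_nhds hC))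
  exact h

lemma isTableRow_of_continuous {k : ℕ} {A B : ℝ → ℝ} {lo hi : ℝ} {Zhi Zlo : BipartiteMatrix 3 3}
    (hA : Continuous A) (hB : Continuous B)
    (h : ∀ a b c : ℝ, IsExtremeNu k a b c ↔ (lo < c ∧ c < hi ∧ a = A c ∧ b = B c))
    (hhi : nu k (A hi) (B hi) hi = Zhi) (hlo : nu k (A lo) (B lo) lo = Zlo) :
    IsTableRow k A B lo hi Zhi Zlo := by
  refine ⟨h, ?_, ?_⟩
  · rw [← hhi]
    exact (tendsto_nu k (hA.tendsto _) (hB.tendsto _) Filter.tendsto_id).mono_left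
      nhdsWithin_le_nhds
  · rw [← hlo]
    exact (tendsto_nu k (hA.tendsto _) (hB.tendsto _) Filter.tendsto_id).mono_left
      nhdsWithin_le_nhds

lemma nu_eq_zeta1 {k : ℕ} {a b c : ℝ} (ha : a = 3 / 11) (hb : b = 1 / 11) (hc : c = 1 / 11) :
    nu k a b c = zeta1 := by
  subst ha hb hc
  refine congrArg diag9 (funext fun i => ?_)
  fin_cases i <;> norm_num

lemma two_mul_sqrt_two_sq : (2 * √2) ^ 2 = 8 := by
  rw [mul_pow, Real.sq_sqrt (by norm_num)]; norm_num

lemma isExtremeNu_one_iff_formula (a b c : ℝ) : IsExtremeNu 1 a b c ↔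
    ((9 - 2 * √2) / 73 < c ∧ c < 1 / 11 ∧ a = (1 - 7 * c + √(-73 * c ^ 2 + 18 * c - 1)) / 2 ∧
      b = (1 - 7 * c - √(-73 * c ^ 2 + 18 * c - 1)) / 2) := by
  rw [isExtremeNu_one_iff]
  push_cast
  have h8 := two_mul_sqrt_two_sq
  have h2 : 0 ≤ √2 := Real.sqrt_nonneg 2
  constructor
  · rintro ⟨hc, hcb, hba, hsum, h0⟩
    have hd : -73 * c ^ 2 + 18 * c - 1 = (a - b) ^ 2 := by
      obtain rfl : a = 1 - b - 7 * c := by linarith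
      linear_combination 2 * h0
    have hpos : 0 < (a - b) ^ 2 := pow_pos (by linarith) 2
    -- The discriminant -73c² + 18c - 1 is positive exactly when (9 - 73c)² < 8.
    have h1 := abs_lt_of_sq_lt_sq (a := 9 - 73 * c) (b := 2 * √2)
      (by rw [h8]; linarith) (by positivity)
    have h3 := (abs_lt.1 h1).2
    rw [hd, Real.sqrt_sq (by linarith)]
    refine ⟨by linarith, ?_, by linarith, by linarith⟩
    have h4 : (a - b) ^ 2 < (1 - 9 * c) ^ 2 := pow_lt_pow_left₀ (by linarith) (by linarith) two_ne_zero
    have h5 : 0 < (1 - 11 * c) * (1 - 7 * c) := by linarith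
    have h6 := pos_of_mul_pos_left h5 (by linarith)
    linarith
  · rintro ⟨hlo, hhi, ha, hb⟩
    have hr : √2 < 3 / 2 := by rw [Real.sqrt_lt' (by norm_num)]; norm_num
    have hd : 0 < -73 * c ^ 2 + 18 * c - 1 := by
      have h1 : (9 - 73 * c) ^ 2 < (2 * √2) ^ 2 := by
        apply sq_lt_sq'
        · linarith
        · linarith
      linarith
    have hs := Real.sq_sqrt hd.le
    have hs0 := Real.sqrt_pos.2 hd
    have hs1 : √(-73 * c ^ 2 + 18 * c - 1) < 1 - 9 * c := by
      rw [Real.sqrt_lt' (by linarith)]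
      have : 0 < (1 - 11 * c) * (1 - 7 * c) := mul_pos (by linarith) (by linarith)
      linarith
    set s := √(-73 * c ^ 2 + 18 * c - 1)
    refine ⟨by linarith, by linarith, by linarith, by linarith, ?_⟩
    rw [ha, hb]
    linear_combination (-1 / 2) * hs

lemma isTableRow_one : IsTableRow 1
      (fun c => (1 - 7 * c + √(-73 * c ^ 2 + 18 * c - 1)) / 2)
      (fun c => (1 - 7 * c - √(-73 * c ^ 2 + 18 * c - 1)) / 2)
      ((9 - 2 * √2) / 73) (1 / 11) zeta1 zeta2 := by
  refine isTableRow_of_continuous (by fun_prop) (by fun_prop) isExtremeNu_one_iff_formula ?_ ?_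
  · have : √(-73 * (1 / 11) ^ 2 + 18 * (1 / 11) - 1) = (2 / 11 : ℝ) := by
      rw [Real.sqrt_eq_iff_mul_self_eq_of_pos (by norm_num)]; norm_num
    refine nu_eq_zeta1 ?_ ?_ rfl <;> simp only [this] <;> norm_num
  · have h8 := two_mul_sqrt_two_sq
    have hc : (9 - 2 * √2) / 73 = 1 / (9 + 2 * √2) := by
      rw [div_eq_div_iff (by norm_num) (by positivity)]
      linear_combination -h8
    have hs : √(-73 * ((9 - 2 * √2) / 73) ^ 2 + 18 * ((9 - 2 * √2) / 73) - 1) = 0 := by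
      rw [Real.sqrt_eq_zero']
      refine le_of_eq ?_
      linear_combination (-1 / 73) * h8
    have h1 : (1 - 7 * ((9 - 2 * √2) / 73)) / 2 = 1 / (9 + 2 * √2) * (√2 + 1) := by
      rw [← hc]
      linear_combination (1 / 146) * h8
    simp only [hs, add_zero, sub_zero, h1]
    refine congrArg diag9 (funext fun i => ?_)
    fin_cases i <;> simp [hc]

lemma isExtremeNu_two_iff_formula (a b c : ℝ) : IsExtremeNu 2 a b c ↔
    (1 / 12 < c ∧ c < 1 / 11 ∧ a = 1 - 10 * c + 2 * √(12 * c ^ 2 - c) ∧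
      b = 2 * c - √(12 * c ^ 2 - c)) := by
  rw [isExtremeNu_two_iff]
  push_cast
  constructor
  · rintro ⟨hc, hcb, hba, hsum, h0⟩
    obtain rfl : a = 1 - 2 * b - 6 * c := by linarith
    have hd : 12 * c ^ 2 - c = (2 * c - b) ^ 2 := by linear_combination h0
    have h12 : 0 ≤ c * (12 * c - 1) := by
      have := sq_nonneg (2 * c - b)
      linarith
    have h12' := nonneg_of_mul_nonneg_right h12 hc
    have hb2 : b < 2 * c := by linarith
    have hd' : 0 < c * (12 * c - 1) := by
      have := pow_pos (sub_pos.2 hb2) 2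
      linarith
    have h12'' := pos_of_mul_pos_right hd' hc.le
    rw [hd, Real.sqrt_sq (by linarith)]
    refine ⟨by linarith, ?_, by ring, by ring⟩
    have h4 : (2 * c - b) ^ 2 < c ^ 2 := pow_lt_pow_left₀ (by linarith) (by linarith) two_ne_zero
    have h5 : 0 < c * (1 - 11 * c) := by linarith
    have h6 := pos_of_mul_pos_right h5 hc.le
    linarith
  · rintro ⟨hlo, hhi, ha, hb⟩
    have hc : 0 < c := by linarith
    have hd : 0 < 12 * c ^ 2 - c := by
      have := mul_pos hc (sub_pos.2 hlo)
      linarith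
    have hs := Real.sq_sqrt hd.le
    have hs0 := Real.sqrt_pos.2 hd
    have hs1 : √(12 * c ^ 2 - c) < c := by
      rw [Real.sqrt_lt' hc]
      have := mul_pos hc (sub_pos.2 hhi)
      linarith
    -- This is the inequality b < a, since a - b = 1 - 12c + 3s for the square root s.
    have hs2 : (12 * c - 1) / 3 < √(12 * c ^ 2 - c) := by
      apply Real.lt_sqrt_of_sq_lt
      have := mul_pos (sub_pos.2 hlo) (by linarith : 0 < 1 - 3 * c)
      linarith
    set s := √(12 * c ^ 2 - c)
    refine ⟨hc, by linarith, by linarith, by linarith, ?_⟩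
    rw [ha, hb]
    linear_combination -hs

lemma isTableRow_two : IsTableRow 2
      (fun c => 1 - 10 * c + 2 * √(12 * c ^ 2 - c))
      (fun c => 2 * c - √(12 * c ^ 2 - c))
      (1 / 12) (1 / 11) zeta1 zeta3 := by
  refine isTableRow_of_continuous (by fun_prop) (by fun_prop) isExtremeNu_two_iff_formula ?_ ?_
  · have : √(12 * (1 / 11) ^ 2 - 1 / 11) = (1 / 11 : ℝ) := by
      rw [Real.sqrt_eq_iff_mul_self_eq_of_pos (by norm_num)]; norm_num
    refine nu_eq_zeta1 ?_ ?_ rfl <;> simp only [this] <;> norm_num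
  · have : √(12 * (1 / 12) ^ 2 - 1 / 12 : ℝ) = 0 := by
      rw [Real.sqrt_eq_zero']; norm_num
    simp only [this]
    refine congrArg diag9 (funext fun i => ?_)
    fin_cases i <;> norm_num

lemma isExtremeNu_three_iff_formula (a b c : ℝ) : IsExtremeNu 3 a b c ↔
    ((10 - √17) / 83 < c ∧ c < 1 / 11 ∧
      a = (1 + 10 * c - 3 * √(108 * c ^ 2 - 20 * c + 1)) / 4 ∧
      b = (1 - 10 * c + √(108 * c ^ 2 - 20 * c + 1)) / 4) := by
  rw [isExtremeNu_three_iff]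
  push_cast
  have h17 : √17 ^ 2 = 17 := Real.sq_sqrt (by norm_num)
  have h17' : 0 ≤ √17 := Real.sqrt_nonneg 17
  constructor
  · rintro ⟨hc, hcb, hba, hsum, h0⟩
    have hb := hc.trans hcb
    obtain rfl : a = 1 - 3 * b - 5 * c := by linarith
    have hq : 2 * b ^ 2 + (10 * c - 1) * b - c ^ 2 = 0 := by linear_combination h0
    have hd : 108 * c ^ 2 - 20 * c + 1 = (4 * b + 10 * c - 1) ^ 2 := by
      linear_combination (-8) * hq
    -- The quadratic for b has roots of opposite sign; b is the positive one, which fixes the sign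
    -- of the square root.
    have hpos : 0 < 4 * b + 10 * c - 1 := by
      refine pos_of_mul_pos_right (a := b) ?_ hb.le
      have : 0 < 2 * b ^ 2 + c ^ 2 := by positivity
      linarith
    rw [hd, Real.sqrt_sq hpos.le]
    refine ⟨?_, ?_, by ring, by ring⟩
    · have h4 : (4 * b + 10 * c - 1) ^ 2 < (5 * c) ^ 2 :=
        pow_lt_pow_left₀ (by linarith) (by linarith) two_ne_zero
      have h1 := abs_lt_of_sq_lt_sq (a := 10 - 83 * c) (b := √17) (by rw [h17]; linarith) h17'
      linarith [(abs_lt.1 h1).2]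
    · have h5 : 0 < (b - c) * (1 - 11 * c) := by
        have : 0 < (b - c) ^ 2 := pow_pos (by linarith) 2
        have hc1 : 0 < c * (1 - 11 * c) + (b - c) * (b - c) * 3 := by
          nlinarith
        nlinarith
      linarith [pos_of_mul_pos_right h5 (by linarith)]
  · rintro ⟨hlo, hhi, ha, hb⟩
    have hr : √17 < 5 := by rw [Real.sqrt_lt' (by norm_num)]; norm_num
    have hr' : 4 < √17 := by rw [Real.lt_sqrt (by norm_num)]; norm_num
    have hc : 0 < c := by linarith
    have hd5 : 108 * c ^ 2 - 20 * c + 1 < (5 * c) ^ 2 := by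
      have h1 : (10 - 83 * c) ^ 2 < √17 ^ 2 := by
        apply sq_lt_sq' <;> linarith
      linarith
    have hd : 0 < 108 * c ^ 2 - 20 * c + 1 := by nlinarith [sq_nonneg (54 * c - 5)]
    have hs := Real.sq_sqrt hd.le
    have hs0 := Real.sqrt_pos.2 hd
    have hs1 : √(108 * c ^ 2 - 20 * c + 1) < 5 * c := by
      rwa [Real.sqrt_lt' (by linarith)]
    have hs2 : 14 * c - 1 < √(108 * c ^ 2 - 20 * c + 1) := by
      apply Real.lt_sqrt_of_sq_lt
      have := mul_pos hc (sub_pos.2 hhi)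
      linarith
    set s := √(108 * c ^ 2 - 20 * c + 1)
    refine ⟨hc, by linarith, by linarith, by linarith, ?_⟩
    rw [ha, hb]
    linear_combination (1 / 8) * hs

lemma isTableRow_three : IsTableRow 3
      (fun c => (1 + 10 * c - 3 * √(108 * c ^ 2 - 20 * c + 1)) / 4)
      (fun c => (1 - 10 * c + √(108 * c ^ 2 - 20 * c + 1)) / 4)
      ((10 - √17) / 83) (1 / 11) zeta1 zeta4 := by
  refine isTableRow_of_continuous (by fun_prop) (by fun_prop) isExtremeNu_three_iff_formula ?_ ?_
  · have : √(108 * (1 / 11) ^ 2 - 20 * (1 / 11) + 1) = (3 / 11 : ℝ) := by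
      rw [Real.sqrt_eq_iff_mul_self_eq_of_pos (by norm_num)]; norm_num
    refine nu_eq_zeta1 ?_ ?_ rfl <;> simp only [this] <;> norm_num
  · have h17 : √17 ^ 2 = 17 := Real.sq_sqrt (by norm_num)
    have hr : √17 < 5 := by rw [Real.sqrt_lt' (by norm_num)]; norm_num
    have hc : (10 - √17) / 83 = 1 / (10 + √17) := by
      rw [div_eq_div_iff (by norm_num) (by positivity)]
      linear_combination -h17
    have hs : √(108 * ((10 - √17) / 83) ^ 2 - 20 * ((10 - √17) / 83) + 1)
        = 5 * ((10 - √17) / 83) := by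
      rw [Real.sqrt_eq_iff_mul_self_eq_of_pos (by linarith)]
      linear_combination (-1 / 83) * h17
    have h1 : (1 + 10 * ((10 - √17) / 83) - 3 * (5 * ((10 - √17) / 83))) / 4
        = 1 / (10 + √17) * ((5 + √17) / 4) := by
      rw [← hc]
      linear_combination (1 / 332) * h17
    have h2 : (1 - 10 * ((10 - √17) / 83) + 5 * ((10 - √17) / 83)) / 4
        = 1 / (10 + √17) * ((5 + √17) / 4) := by
      rw [← hc]
      linear_combination (1 / 332) * h17
    simp only [hs, h1, h2]
    refine congrArg diag9 (funext fun i => ?_)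
    fin_cases i <;> simp [hc]

lemma isExtremeNu_six_iff_formula (a b c : ℝ) : IsExtremeNu 6 a b c ↔
    ((23 - 14 * √2) / 137 < c ∧ c < 1 / 11 ∧ a = (2 * c + √(6 * c - 17 * c ^ 2)) / 3 ∧
      b = (3 - 8 * c - √(6 * c - 17 * c ^ 2)) / 18) := by
  rw [isExtremeNu_six_iff]
  push_cast
  have h2 : √2 ^ 2 = 2 := Real.sq_sqrt (by norm_num)
  have h2' : 0 ≤ √2 := Real.sqrt_nonneg 2
  constructor
  · rintro ⟨hc, hcb, hba, hsum, h0⟩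
    have hd : 6 * c - 17 * c ^ 2 = (3 * a - 2 * c) ^ 2 := by
      linear_combination 9 * h0 - 6 * c * hsum
    have hac : 2 * c < a - c := by
      refine lt_of_pow_lt_pow_left₀ 2 (by linarith) ?_
      linarith [mul_lt_mul_of_pos_left hcb hc]
    rw [hd, Real.sqrt_sq (by linarith)]
    have h7 : (7 * c) ^ 2 < (3 * a - 2 * c) ^ 2 :=
      pow_lt_pow_left₀ (by linarith) (by linarith) two_ne_zero
    have h11 : c < 1 / 11 := by
      have : 0 < c * (1 - 11 * c) := by linarith
      linarith [pos_of_mul_pos_right this hc.le]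
    refine ⟨?_, h11, by ring, by linarith⟩
    have h8 : (3 - 20 * c) ^ 2 < (7 * (3 * a - 2 * c)) ^ 2 :=
      pow_lt_pow_left₀ (by linarith) (by linarith) two_ne_zero
    have h1 := abs_lt_of_sq_lt_sq (a := 23 - 137 * c) (b := 14 * √2) (by
      rw [mul_pow, h2]; linarith) (by positivity)
    linarith [(abs_lt.1 h1).2]
  · rintro ⟨hlo, hhi, ha, hb⟩
    have hr : √2 < 23 / 14 := by rw [Real.sqrt_lt' (by norm_num)]; norm_num
    have hr' : 1 < √2 := by rw [Real.lt_sqrt (by norm_num)]; norm_num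
    have hc : 0 < c := by linarith
    have hd : 0 < 6 * c - 17 * c ^ 2 := by
      have := mul_pos hc (by linarith : 0 < 6 - 17 * c)
      linarith
    have hs := Real.sq_sqrt hd.le
    have hs1 : 7 * c < √(6 * c - 17 * c ^ 2) := by
      apply Real.lt_sqrt_of_sq_lt
      have := mul_pos hc (sub_pos.2 hhi)
      linarith
    -- This is b < a, and the bound `hs3` below is c < b.
    have hs2 : (3 - 20 * c) / 7 < √(6 * c - 17 * c ^ 2) := by
      apply Real.lt_sqrt_of_sq_lt
      have h1 : (23 - 137 * c) ^ 2 < (14 * √2) ^ 2 := by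
        apply sq_lt_sq' <;> linarith
      rw [mul_pow, h2] at h1
      linarith
    have hs3 : √(6 * c - 17 * c ^ 2) < 3 - 26 * c := by
      rw [Real.sqrt_lt' (by linarith)]
      have := mul_pos (sub_pos.2 hhi) (by linarith : 0 < 1 - 7 * c)
      linarith
    set s := √(6 * c - 17 * c ^ 2)
    refine ⟨hc, by linarith, by linarith, by linarith, ?_⟩
    rw [ha, hb]
    linear_combination (-1 / 9) * hs

lemma isTableRow_six : IsTableRow 6
      (fun c => (2 * c + √(6 * c - 17 * c ^ 2)) / 3)
      (fun c => (3 - 8 * c - √(6 * c - 17 * c ^ 2)) / 18)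
      ((23 - 14 * √2) / 137) (1 / 11) zeta1 zeta7 := by
  refine isTableRow_of_continuous (by fun_prop) (by fun_prop) isExtremeNu_six_iff_formula ?_ ?_
  · have : √(6 * (1 / 11) - 17 * (1 / 11) ^ 2) = (7 / 11 : ℝ) := by
      rw [Real.sqrt_eq_iff_mul_self_eq_of_pos (by norm_num)]; norm_num
    refine nu_eq_zeta1 ?_ ?_ rfl <;> simp only [this] <;> norm_num
  · have h2 : √2 ^ 2 = 2 := Real.sq_sqrt (by norm_num)
    have hr : √2 < 23 / 14 := by rw [Real.sqrt_lt' (by norm_num)]; norm_num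
    have hc : (23 - 14 * √2) / 137 = 1 / (23 + 14 * √2) := by
      rw [div_eq_div_iff (by norm_num) (by positivity)]
      linear_combination (-196) * h2
    have hs : √(6 * ((23 - 14 * √2) / 137) - 17 * ((23 - 14 * √2) / 137) ^ 2)
        = (7 + 6 * √2) * ((23 - 14 * √2) / 137) := by
      have : 0 < 23 - 14 * √2 := by linarith
      rw [Real.sqrt_eq_iff_mul_self_eq_of_pos (by positivity)]
      linear_combination (1 / 18769) * (7056 * √2 ^ 2 - 6720 * √2 - 8004) * h2
    have h3 : (2 * ((23 - 14 * √2) / 137) + (7 + 6 * √2) * ((23 - 14 * √2) / 137)) / 3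
        = 1 / (23 + 14 * √2) * (3 + 2 * √2) := by
      rw [← hc]; ring
    have h4 : (3 - 8 * ((23 - 14 * √2) / 137) - (7 + 6 * √2) * ((23 - 14 * √2) / 137)) / 18
        = 1 / (23 + 14 * √2) * (3 + 2 * √2) := by
      rw [← hc]
      linear_combination (98 / 411) * h2
    simp only [hs, h3, h4]
    refine congrArg diag9 (funext fun i => ?_)
    fin_cases i <;> simp [hc]

lemma isExtremeNu_seven_iff_formula (a b c : ℝ) : IsExtremeNu 7 a b c ↔
    (0 < c ∧ c < 1 / 11 ∧ a = (4 - 11 * c + 7 * √(8 * c - 7 * c ^ 2)) / 32 ∧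
      b = (4 - 3 * c - √(8 * c - 7 * c ^ 2)) / 32) := by
  rw [isExtremeNu_seven_iff]
  push_cast
  constructor
  · rintro ⟨hc, hcb, hba, hsum, h0⟩
    obtain rfl : a = 1 - 7 * b - c := by linarith
    have hd : 8 * c - 7 * c ^ 2 = (4 - 3 * c - 32 * b) ^ 2 := by
      linear_combination 16 * h0
    have hpos : 0 ≤ 4 - 3 * c - 32 * b := by linarith
    rw [hd, Real.sqrt_sq hpos]
    refine ⟨hc, ?_, by ring, by ring⟩
    have h4 : (4 - 3 * c - 32 * b) ^ 2 < (4 - 35 * c) ^ 2 :=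
      pow_lt_pow_left₀ (by linarith) hpos two_ne_zero
    have h5 : 0 < (1 - 11 * c) * (1 - 7 * c) := by linarith
    linarith [pos_of_mul_pos_left h5 (by linarith)]
  · rintro ⟨hc, hhi, ha, hb⟩
    have hd : 0 < 8 * c - 7 * c ^ 2 := by
      have := mul_pos hc (by linarith : 0 < 8 - 7 * c)
      linarith
    have hs := Real.sq_sqrt hd.le
    have hs1 : c < √(8 * c - 7 * c ^ 2) := by
      apply Real.lt_sqrt_of_sq_lt
      have := mul_pos hc (by linarith : 0 < 1 - c)
      linarith
    have hs2 : √(8 * c - 7 * c ^ 2) < 4 - 35 * c := by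
      rw [Real.sqrt_lt' (by linarith)]
      have := mul_pos (sub_pos.2 hhi) (by linarith : 0 < 1 - 7 * c)
      linarith
    set s := √(8 * c - 7 * c ^ 2)
    refine ⟨hc, by linarith, by linarith, by linarith, ?_⟩
    rw [ha, hb]
    linear_combination (-1 / 16) * hs

lemma isTableRow_seven : IsTableRow 7
      (fun c => (4 - 11 * c + 7 * √(8 * c - 7 * c ^ 2)) / 32)
      (fun c => (4 - 3 * c - √(8 * c - 7 * c ^ 2)) / 32)
      0 (1 / 11) zeta1 zeta8 := by
  refine isTableRow_of_continuous (by fun_prop) (by fun_prop) isExtremeNu_seven_iff_formula ?_ ?_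
  · have : √(8 * (1 / 11) - 7 * (1 / 11) ^ 2) = (9 / 11 : ℝ) := by
      rw [Real.sqrt_eq_iff_mul_self_eq_of_pos (by norm_num)]; norm_num
    refine nu_eq_zeta1 ?_ ?_ rfl <;> simp only [this] <;> norm_num
  · refine congrArg diag9 (funext fun i => ?_)
    fin_cases i <;> norm_num

/-! ### The row given by the second root of a cubic -/

lemma roots_eq_of_natDegree_eq_three {p : ℝ[X]} (hp : p.natDegree = 3) {r₁ r₂ r₃ : ℝ}
    (h12 : r₁ < r₂) (h23 : r₂ < r₃) (h1 : p.eval r₁ = 0) (h2 : p.eval r₂ = 0)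
    (h3 : p.eval r₃ = 0) : p.roots = {r₁, r₂, r₃} := by
  have hp0 : p ≠ 0 := by rintro rfl; simp at hp
  symm
  refine Multiset.eq_of_le_of_card_le ?_ ?_
  · rw [Multiset.le_iff_subset]
    · intro x hx
      simp only [Multiset.insert_eq_cons, Multiset.mem_cons, Multiset.mem_singleton] at hx
      rw [mem_roots hp0, IsRoot.def]
      rcases hx with rfl | rfl | rfl <;> assumption
    · simp [h12.ne, h23.ne, (h12.trans h23).ne]
  · refine (card_roots' p).trans ?_
    rw [hp]; simp

/-- A cubic with the sign pattern `-, +, -, +` has its second root between the two middle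
points, and no other root there. -/
lemma exists_isSecondRoot {p : ℝ[X]} (hp : p.natDegree = 3) {x₀ x₁ x₂ x₃ : ℝ}
    (h01 : x₀ < x₁) (h12 : x₁ < x₂) (h23 : x₂ < x₃) (e0 : p.eval x₀ < 0) (e1 : 0 < p.eval x₁)
    (e2 : p.eval x₂ < 0) (e3 : 0 < p.eval x₃) :
    ∃ r, x₁ < r ∧ r < x₂ ∧ IsSecondRoot p r ∧ p.eval r = 0 ∧
      ∀ t, x₁ < t → t < x₂ → p.eval t = 0 → t = r := by
  have hp0 : p ≠ 0 := by rintro rfl; simp at hp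
  have hc : ∀ s, ContinuousOn (fun t => p.eval t) s := fun s => p.continuous.continuousOn
  obtain ⟨r₁, hr₁, z1⟩ := intermediate_value_Ioo h01.le (hc _) ⟨e0, e1⟩
  obtain ⟨r₂, hr₂, z2⟩ := intermediate_value_Ioo' h12.le (hc _) ⟨e2, e1⟩
  obtain ⟨r₃, hr₃, z3⟩ := intermediate_value_Ioo h23.le (hc _) ⟨e2, e3⟩
  have l12 := hr₁.2.trans hr₂.1
  have l23 := hr₂.2.trans hr₃.1
  have hroots := roots_eq_of_natDegree_eq_three hp l12 l23 z1 z2 z3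
  refine ⟨r₂, hr₂.1, hr₂.2, ⟨r₁, r₃, l12.le, l23.le, hroots⟩, z2, fun t ht1 ht2 ht => ?_⟩
  have hm : t ∈ p.roots := (mem_roots hp0).2 ht
  rw [hroots] at hm
  simp only [Multiset.insert_eq_cons, Multiset.mem_cons, Multiset.mem_singleton] at hm
  rcases hm with rfl | rfl | rfl
  · exact absurd hr₁.2 (not_lt.2 ht1.le)
  · rfl
  · exact absurd hr₃.1 (not_lt.2 ht2.le)

lemma exists_lower_endpoint : ∃ y : ℝ,
    IsSecondRoot (C 481 * X ^ 3 - C 37 * X ^ 2 - C 17 * X + C 1) y ∧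
    1 / 17.546425 < y ∧ y < 1 / 17.546375 ∧ 481 * y ^ 3 - 37 * y ^ 2 - 17 * y + 1 = 0 := by
  obtain ⟨y, h1, h2, h3, h4, -⟩ := exists_isSecondRoot
    (p := C 481 * X ^ 3 - C 37 * X ^ 2 - C 17 * X + C 1) (by compute_degree!)
    -- The middle points come from x = (1/y - 4)/5: the bounds 2.709275 and 2.709285 on x become
    -- 17.546375 and 17.546425 for 1/y = 5x + 4.
    (x₀ := -1) (x₁ := 1 / 17.546425) (x₂ := 1 / 17.546375) (x₃ := 1)
    (by norm_num) (by norm_num) (by norm_num) (by simp; norm_num) (by simp; norm_num)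
    (by simp; norm_num) (by simp; norm_num)
  refine ⟨y, h3, h1, h2, ?_⟩
  simpa using h4

/-- The cubic whose second root is the entry `b` of the extreme states `nu 4 a b c`. -/
noncomputable def nuFourCubic (c : ℝ) : ℝ[X] :=
  C 16 * X ^ 3 + C (41 * c - 8) * X ^ 2 + C (19 * c ^ 2 - 10 * c + 1) * X + C (c ^ 3)

lemma nuFourCubic_eval (c t : ℝ) : (nuFourCubic c).eval t =
    t * (1 - 4 * t - 5 * c) ^ 2 + c * (t - c) ^ 2 - 4 * c ^ 2 * t := by
  simp only [nuFourCubic, eval_add, eval_mul, eval_pow, eval_X, eval_C]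
  ring

/-- At t = c the cubic equals c(1 - 11c)(1 - 7c) > 0. At t = (1 - 4c)/5, which means a = b, it
equals (481c³ - 37c² - 17c + 1)/125. Hence c < b < a isolates the second root. -/
lemma exists_nuFourCubic_root {c : ℝ} (hc : 0 < c) (hc' : c < 1 / 11)
    (hg : 481 * c ^ 3 - 37 * c ^ 2 - 17 * c + 1 < 0) :
    ∃ r, c < r ∧ r < (1 - 4 * c) / 5 ∧ IsSecondRoot (nuFourCubic c) r ∧
      (nuFourCubic c).eval r = 0 ∧
      ∀ t, c < t → t < (1 - 4 * c) / 5 → (nuFourCubic c).eval t = 0 → t = r := by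
  refine exists_isSecondRoot (x₀ := -1) (x₃ := 1) ?_ (by linarith) (by linarith) (by linarith)
    ?_ ?_ ?_ ?_
  · unfold nuFourCubic
    compute_degree!
  · rw [nuFourCubic_eval]
    have : 0 < (1 - c) * c := mul_pos (by linarith) hc
    nlinarith [mul_pos this hc]
  · rw [nuFourCubic_eval]
    have := mul_pos hc (mul_pos (by linarith : 0 < 1 - 11 * c) (by linarith : 0 < 1 - 7 * c))
    linarith
  · rw [nuFourCubic_eval]
    linarith
  · rw [nuFourCubic_eval]
    have := mul_pos hc hc
    nlinarith [mul_pos this hc]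

/-! ### Estimates on the boundary curve for k = 4 -/

section bounds

variable {a b c : ℝ}

lemma nuFour_sub_le_two_mul (hb : 0 < b) (hc : 0 < c)
    (h0 : 4 * c ^ 2 * b - b * (a - c) ^ 2 - c * (b - c) ^ 2 = 0) : a - c ≤ 2 * c := by
  refine le_of_sq_le_sq ?_ (by positivity)
  refine le_of_mul_le_mul_left ?_ hb
  have : 0 ≤ c * (b - c) ^ 2 := by positivity
  linarith

/-- At a - c = 2c - (b - c) the boundary polynomial would still be positive, so a smaller positive
value of a - c cannot be a zero. With the trace condition this bounds b - c by a multiple of 1 -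
11c. -/
lemma nuFour_two_mul_sub_le (hcb : c < b) (hc : 0 < c) (hac : 0 < a - c)
    (h0 : 4 * c ^ 2 * b - b * (a - c) ^ 2 - c * (b - c) ^ 2 = 0) :
    2 * c - (b - c) ≤ a - c := by
  have hb := hc.trans hcb
  by_contra! hlt
  have h1 : (a - c) ^ 2 < (2 * c - (b - c)) ^ 2 := pow_lt_pow_left₀ hlt hac.le two_ne_zero
  have h2 := mul_lt_mul_of_pos_left h1 hb
  have h3 : 0 < (b - c) * (b * (2 * c - (b - c)) + c * (2 * b - (b - c))) := by
    refine mul_pos (by linarith) (add_pos (mul_pos hb (by linarith)) (mul_pos hc (by linarith)))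
  linarith

/-- The quantity (1 - 4c)/5 - b equals (a - b)/5. The bound serves twice: it makes the cubic in c
negative when a > b, and it drives a - b to zero as c tends to the root of that cubic. -/
lemma nuFour_gap_bound (hcb : c < b) (hba : b < a) (hc : 0 < c)
    (hsum : a + 4 * b + 4 * c = 1)
    (h0 : 4 * c ^ 2 * b - b * (a - c) ^ 2 - c * (b - c) ^ 2 = 0) :
    4 * c ^ 2 * ((1 - 4 * c) / 5 - b) ≤ -(481 * c ^ 3 - 37 * c ^ 2 - 17 * c + 1) / 125 := by
  obtain ⟨d, rfl⟩ : ∃ d, a = b + 5 * d := ⟨(a - b) / 5, by ring⟩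
  obtain ⟨e, rfl⟩ : ∃ e, b = c + e := ⟨b - c, by ring⟩
  have hd : 0 < d := by linarith
  have he : 0 < e := by linarith
  have h2 := nuFour_sub_le_two_mul (hc.trans hcb) hc h0
  have hs : c = (1 - 5 * e - 5 * d) / 9 := by linarith
  have key : -(481 * c ^ 3 - 37 * c ^ 2 - 17 * c + 1) / 125 =
      d * (7 * e ^ 2 + 6 * e * c + 22 * e * d + 23 * c * d - d ^ 2 + 4 * c ^ 2) := by
    have hτ : 1 - 4 * c = 5 * (c + e + d) := by linarith
    have hg : (481 * c ^ 3 - 37 * c ^ 2 - 17 * c + 1) / 125 =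
        ((1 - 4 * c) / 5) * ((1 - 4 * c) / 5 - c) ^ 2 + c * ((1 - 4 * c) / 5 - c) ^ 2
          - 4 * c ^ 2 * ((1 - 4 * c) / 5) := by ring
    rw [neg_div, hg, hτ]
    linear_combination h0
  rw [key, show (1 - 4 * c) / 5 - (c + e) = d by linarith]
  have h3 : 0 ≤ d * (7 * e ^ 2 + 6 * e * c + 22 * e * d + d * (23 * c - d)) := by
    have : 0 ≤ 23 * c - d := by linarith
    positivity
  linarith

lemma nuFour_three_mul_sub_le (hcb : c < b) (hac : 0 < a - c) (hc : 0 < c)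
    (hsum : a + 4 * b + 4 * c = 1)
    (h0 : 4 * c ^ 2 * b - b * (a - c) ^ 2 - c * (b - c) ^ 2 = 0) : 3 * (b - c) ≤ 1 - 11 * c := by
  have := nuFour_two_mul_sub_le hcb hc hac h0
  linarith

end bounds

/-- On (0, 1/11) the cubic is strictly decreasing: the difference of its values at c and y has the
factor y - c and a positive cofactor. -/
lemma lowerCubic_neg_iff {y c : ℝ} (hy : 0 < y) (hy' : y < 1 / 11) (hc : 0 < c) (hc' : c < 1 / 11)
    (h : 481 * y ^ 3 - 37 * y ^ 2 - 17 * y + 1 = 0) :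
    481 * c ^ 3 - 37 * c ^ 2 - 17 * c + 1 < 0 ↔ y < c := by
  have hB : 0 < 17 + 37 * (c + y) - 481 * (c ^ 2 + c * y + y ^ 2) := by
    have h1 := mul_pos hc (sub_pos.2 hc')
    have h2 := mul_pos hy (sub_pos.2 hy')
    have h3 := mul_pos hc (sub_pos.2 hy')
    linarith
  have hd : 481 * c ^ 3 - 37 * c ^ 2 - 17 * c + 1
      = (y - c) * (17 + 37 * (c + y) - 481 * (c ^ 2 + c * y + y ^ 2)) := by
    linear_combination h
  rw [hd]
  constructor
  · intro h1
    have := neg_of_mul_neg_left h1 hB.le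
    linarith
  · intro h1
    exact mul_neg_of_neg_of_pos (by linarith) hB

theorem exists_isTableRow_four : ∃ (y x : ℝ) (b₁ : ℝ → ℝ),
      IsSecondRoot (C 481 * X ^ 3 - C 37 * X ^ 2 - C 17 * X + C 1) y ∧
      (0.056991 ≤ y ∧ y < 0.056992) ∧
      (x ^ 3 - x ^ 2 - 5 * x + 1 = 0 ∧ 2.709275 ≤ x ∧ x < 2.709285) ∧
      (∀ c : ℝ, y < c → c < 1 / 11 →
        IsSecondRoot
          (C 16 * X ^ 3 + C (41 * c - 8) * X ^ 2 + C (19 * c ^ 2 - 10 * c + 1) * X + C (c ^ 3))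
          (b₁ c)) ∧
      IsTableRow 4 (fun c => 1 - 4 * b₁ c - 4 * c) b₁ y (1 / 11) zeta1 (zeta5 x) := by
  obtain ⟨y, hy, hy1, hy2, hy0⟩ := exists_lower_endpoint
  have hy1' : 0.056991 < y := lt_trans (by norm_num) hy1
  have hy2' : y < 0.056992 := hy2.trans (by norm_num)
  have hypos : 0 < y := lt_trans (by norm_num) hy1'
  have hy11 : y < 1 / 11 := hy2'.trans (by norm_num)
  have hex : ∀ c : ℝ, ∃ r, y < c → c < 1 / 11 → c < r ∧ r < (1 - 4 * c) / 5 ∧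
      IsSecondRoot (nuFourCubic c) r ∧ (nuFourCubic c).eval r = 0 ∧
      ∀ t, c < t → t < (1 - 4 * c) / 5 → (nuFourCubic c).eval t = 0 → t = r := by
    intro c
    by_cases h : y < c ∧ c < 1 / 11
    · have hc := hypos.trans h.1
      obtain ⟨r, hr⟩ := exists_nuFourCubic_root hc h.2
        ((lowerCubic_neg_iff hypos hy11 hc h.2 hy0).2 h.1)
      exact ⟨r, fun _ _ => hr⟩
    -- Outside the interval the value of the root function is irrelevant and is set to 0.
    · exact ⟨0, fun h1 h2 => absurd ⟨h1, h2⟩ h⟩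
  choose b₁ hb₁ using hex
  have hD : ∀ c, y < c → c < 1 / 11 → 4 * c ^ 2 * b₁ c -
      b₁ c * (1 - 4 * b₁ c - 4 * c - c) ^ 2 - c * (b₁ c - c) ^ 2 = 0 := by
    intro c h1 h2
    have h3 := (hb₁ c h1 h2).2.2.2.1
    rw [nuFourCubic_eval] at h3
    linear_combination -h3
  -- At the lower end a = b = (1 - 4y)/5, so x is the ratio b/c there, and y = 1/(5x + 4) turns the
  -- cubic for y into the one for x.
  refine ⟨y, (1 / y - 4) / 5, b₁, hy, ⟨hy1'.le, hy2'⟩, ⟨?_, ?_, ?_⟩,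
    fun c h1 h2 => (hb₁ c h1 h2).2.2.1, ?_, ?_, ?_⟩
  · field_simp
    linear_combination hy0
  · have : 17.546375 < 1 / y := by rwa [lt_one_div (by norm_num) hypos]
    linarith
  · have : 1 / y < 17.546425 := by rwa [one_div_lt hypos (by norm_num)]
    linarith
  · intro a b c
    rw [isExtremeNu_four_iff]
    push_cast
    constructor
    · rintro ⟨hc, hcb, hba, hsum, h0⟩
      have hsum' : a + 4 * b + 4 * c = 1 := by linarith
      have h11 : c < 1 / 11 := by
        have := nuFour_three_mul_sub_le hcb (by linarith) hc hsum' h0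
        linarith
      have hgap := nuFour_gap_bound hcb hba hc hsum' h0
      have hg : 481 * c ^ 3 - 37 * c ^ 2 - 17 * c + 1 < 0 := by
        have : 0 < 4 * c ^ 2 * ((1 - 4 * c) / 5 - b) :=
          mul_pos (by positivity) (by linarith)
        linarith
      have hyc := (lowerCubic_neg_iff hypos hy11 hc h11 hy0).1 hg
      have hbb : b = b₁ c := by
        refine (hb₁ c hyc h11).2.2.2.2 b hcb (by linarith) ?_
        obtain rfl : a = 1 - 4 * b - 4 * c := by linarith
        rw [nuFourCubic_eval]
        linear_combination -h0
      exact ⟨hyc, h11, by rw [← hbb]; linarith, hbb⟩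
    · rintro ⟨h1, h2, rfl, rfl⟩
      obtain ⟨h3, h4, -⟩ := hb₁ c h1 h2
      exact ⟨hypos.trans h1, h3, by linarith, by ring, hD c h1 h2⟩
  · have hmem : ∀ᶠ c in 𝓝[<] (1 / 11 : ℝ), y < c ∧ c < 1 / 11 :=
      Ioo_mem_nhdsLT hy11
    have hb : Filter.Tendsto b₁ (𝓝[<] (1 / 11)) (𝓝 (1 / 11)) := by
      have l1 : Filter.Tendsto (fun c : ℝ => c) (𝓝[<] (1 / 11)) (𝓝 (1 / 11)) :=
        tendsto_nhdsWithin_of_tendsto_nhds Filter.tendsto_id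
      have l2 : Filter.Tendsto (fun c : ℝ => c + (1 - 11 * c) / 3) (𝓝[<] (1 / 11))
          (𝓝 (1 / 11)) := by
        refine tendsto_nhdsWithin_of_tendsto_nhds ?_
        have : Continuous fun c : ℝ => c + (1 - 11 * c) / 3 := by fun_prop
        convert this.tendsto (1 / 11) using 2
        norm_num
      refine tendsto_of_tendsto_of_tendsto_of_le_of_le' l1 l2 ?_ ?_
      · filter_upwards [hmem] with c hc using (hb₁ c hc.1 hc.2).1.le
      · filter_upwards [hmem] with c hc
        obtain ⟨h3, h4, -⟩ := hb₁ c hc.1 hc.2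
        have := nuFour_three_mul_sub_le h3 (by linarith) (hypos.trans hc.1) (by ring) (hD c hc.1 hc.2)
        linarith
    have hid : Filter.Tendsto (fun c : ℝ => c) (𝓝[<] (1 / 11)) (𝓝 (1 / 11)) :=
      tendsto_nhdsWithin_of_tendsto_nhds Filter.tendsto_id
    have h := tendsto_nu 4 (((hb.const_mul 4).const_sub 1).sub (hid.const_mul 4)) hb hid
    rwa [nu_eq_zeta1 (by norm_num) rfl rfl] at h
  · have hmem : ∀ᶠ c in 𝓝[>] y, y < c ∧ c < 1 / 11 := Ioo_mem_nhdsGT hy11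
    have hid : Filter.Tendsto (fun c : ℝ => c) (𝓝[>] y) (𝓝 y) :=
      tendsto_nhdsWithin_of_tendsto_nhds Filter.tendsto_id
    have hb : Filter.Tendsto b₁ (𝓝[>] y) (𝓝 ((1 - 4 * y) / 5)) := by
      have l1 : Filter.Tendsto (fun c : ℝ => (1 - 4 * c) / 5 +
          (481 * c ^ 3 - 37 * c ^ 2 - 17 * c + 1) / 125 / (4 * c ^ 2)) (𝓝[>] y)
          (𝓝 ((1 - 4 * y) / 5)) := by
        refine tendsto_nhdsWithin_of_tendsto_nhds ?_
        have : ContinuousAt (fun c : ℝ => (1 - 4 * c) / 5 +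
            (481 * c ^ 3 - 37 * c ^ 2 - 17 * c + 1) / 125 / (4 * c ^ 2)) y :=
          ContinuousAt.add (by fun_prop)
            (ContinuousAt.div (by fun_prop) (by fun_prop) (by positivity))
        convert this.tendsto using 2
        rw [hy0]; simp
      have l2 : Filter.Tendsto (fun c : ℝ => (1 - 4 * c) / 5) (𝓝[>] y)
          (𝓝 ((1 - 4 * y) / 5)) :=
        ((hid.const_mul 4).const_sub 1).div_const 5
      refine tendsto_of_tendsto_of_tendsto_of_le_of_le' l1 l2 ?_ ?_
      · filter_upwards [hmem] with c hc
        obtain ⟨h3, h4, -⟩ := hb₁ c hc.1 hc.2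
        have hcpos := hypos.trans hc.1
        have h5 := nuFour_gap_bound h3 (by linarith) hcpos (by ring) (hD c hc.1 hc.2)
        rw [← le_div_iff₀' (by positivity), neg_div, neg_div] at h5
        linarith
      · filter_upwards [hmem] with c hc using (hb₁ c hc.1 hc.2).2.1.le
    have h := tendsto_nu 4 (((hb.const_mul 4).const_sub 1).sub (hid.const_mul 4)) hb hid
    have hz : nu 4 (1 - 4 * ((1 - 4 * y) / 5) - 4 * y) ((1 - 4 * y) / 5) y
        = zeta5 ((1 / y - 4) / 5) := by
      have e1 : 1 / (5 * ((1 / y - 4) / 5) + 4) = y := by field_simp; simp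
      have e2 : y * ((1 / y - 4) / 5) = (1 - 4 * y) / 5 := by field_simp
      have e3 : 1 - 4 * ((1 - 4 * y) / 5) - 4 * y = (1 - 4 * y) / 5 := by ring
      rw [zeta5, e1, e3, ← e2]
      refine congrArg diag9 (funext fun i => ?_)
      fin_cases i <;> simp
    rwa [hz] at h

theorem mainTheorem5 :
    -- k = 1
    IsTableRow 1
      (fun c => (1 - 7 * c + √(-73 * c ^ 2 + 18 * c - 1)) / 2)
      (fun c => (1 - 7 * c - √(-73 * c ^ 2 + 18 * c - 1)) / 2)
      ((9 - 2 * √2) / 73) (1 / 11) zeta1 zeta2 ∧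
    -- k = 2
    IsTableRow 2
      (fun c => 1 - 10 * c + 2 * √(12 * c ^ 2 - c))
      (fun c => 2 * c - √(12 * c ^ 2 - c))
      (1 / 12) (1 / 11) zeta1 zeta3 ∧
    -- k = 3
    IsTableRow 3
      (fun c => (1 + 10 * c - 3 * √(108 * c ^ 2 - 20 * c + 1)) / 4)
      (fun c => (1 - 10 * c + √(108 * c ^ 2 - 20 * c + 1)) / 4)
      ((10 - √17) / 83) (1 / 11) zeta1 zeta4 ∧
    -- k = 4
    (∃ (y x : ℝ) (b₁ : ℝ → ℝ),
      IsSecondRoot (C 481 * X ^ 3 - C 37 * X ^ 2 - C 17 * X + C 1) y ∧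
      (0.056991 ≤ y ∧ y < 0.056992) ∧
      (x ^ 3 - x ^ 2 - 5 * x + 1 = 0 ∧ 2.709275 ≤ x ∧ x < 2.709285) ∧
      (∀ c : ℝ, y < c → c < 1 / 11 →
        IsSecondRoot
          (C 16 * X ^ 3 + C (41 * c - 8) * X ^ 2 + C (19 * c ^ 2 - 10 * c + 1) * X + C (c ^ 3))
          (b₁ c)) ∧
      IsTableRow 4 (fun c => 1 - 4 * b₁ c - 4 * c) b₁ y (1 / 11) zeta1 (zeta5 x)) ∧
    -- k = 5
    (∀ a b c : ℝ, ¬ IsExtremeNu 5 a b c) ∧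
    -- k = 6
    IsTableRow 6
      (fun c => (2 * c + √(6 * c - 17 * c ^ 2)) / 3)
      (fun c => (3 - 8 * c - √(6 * c - 17 * c ^ 2)) / 18)
      ((23 - 14 * √2) / 137) (1 / 11) zeta1 zeta7 ∧
    -- k = 7
    IsTableRow 7
      (fun c => (4 - 11 * c + 7 * √(8 * c - 7 * c ^ 2)) / 32)
      (fun c => (4 - 3 * c - √(8 * c - 7 * c ^ 2)) / 32)
      0 (1 / 11) zeta1 zeta8 ∧
    -- decimal values of the endpoints
    (0.084542 ≤ (9 - 2 * √2) / 73 ∧ (9 - 2 * √2) / 73 < 0.084543) ∧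
    (0.083333 ≤ (1 / 12 : ℝ) ∧ (1 / 12 : ℝ) < 0.083334) ∧
    (0.070805 ≤ (10 - √17) / 83 ∧ (10 - √17) / 83 < 0.070806) ∧
    (0.023365 ≤ (23 - 14 * √2) / 137 ∧ (23 - 14 * √2) / 137 < 0.023366) ∧
    (0.090909 ≤ (1 / 11 : ℝ) ∧ (1 / 11 : ℝ) < 0.090910) := by
  have h2l : 1.414213 < √2 := by rw [Real.lt_sqrt (by norm_num)]; norm_num
  have h2u : √2 < 1.4142136 := by rw [Real.sqrt_lt' (by norm_num)]; norm_num
  have h17l : 4.123105 < √17 := by rw [Real.lt_sqrt (by norm_num)]; norm_num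
  have h17u : √17 < 4.123106 := by rw [Real.sqrt_lt' (by norm_num)]; norm_num
  refine ⟨isTableRow_one, isTableRow_two, isTableRow_three, exists_isTableRow_four,
    fun _ _ _ => not_isExtremeNu_five, isTableRow_six, isTableRow_seven, ⟨?_, ?_⟩,
    ⟨by norm_num, by norm_num⟩, ⟨?_, ?_⟩, ⟨?_, ?_⟩, ⟨by norm_num, by norm_num⟩⟩ <;> linarith
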